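/- Let $\mathcal F=(F,<,+,\cdot,0,1,\dots)$ be an expansion of an ordered field that is definably complete (every definable subset of $F$ has a supremum and an infimum in $F\cup\{\pm\infty\}$) and locally o-minimal (for every definable $S\subseteq F$ and every $a\in F$ there is an open interval $I\ni a$ such that $S\cap I$ is a finite union of points and open intervals). Here ``definable'' means definable with parameters, $F$ carries the order topology, $F^n$ the product topology, and subsets of $F^n$ the relative topology. A definable continuous map $f:X\to Y$ between definable sets $X\subseteq F^m$, $Y\subseteq F^n$ is \emph{definably proper} if for every closed bounded definable set $K\subseteq F^n$ with $K\subseteq Y$ the set $f^{-1}(K)$ is closed and bounded in $F^m$. It is \emph{definably identifying} if it is surjective and every definable $K\subseteq Y$ for which $f^{-1}(K)$ is closed in $X$ is closed in $Y$. A \emph{definable proper quotient} of a definable set $T$ by a definable equivalence relation $E\subseteq T\times T$ is a definably identifying and definably proper map $p:T\to Z$ onto a definable set $Z\subseteq F^N$, for some $N$, such that $p(x)=p(x')$ if and only if $(x,x')\in E$. A \emph{disjoint sum} $X\amalg Y$ is a definable set $T\subseteq F^k$ with definable maps $h_1:X\to T$, $h_2:Y\to T$ that are homeomorphisms onto their images,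 such that $h_1(X)$ and $h_2(Y)$ are open in $T$ and $T$ is their disjoint union; $X$ and $Y$ are identified with their images. \textbf{Proposition.} Let $X\subseteq F^m$, $Y\subseteq F^n$ and $A\subseteq X$ be definable sets, and let $f:A\to Y$ be a definably proper map. Assume that $X$ is locally closed in $F^m$ and that $A$ is closed in $X$. Then $X\amalg_f Y$ exists as a definable proper quotient. That is, a disjoint sum of $X$ and $Y$ exists, and for every disjoint sum $X\amalg Y$, the relation $$E(f)=\Delta(X)\cup\Delta(Y)\cup\{(a,f(a)) : a\in A\}\cup\{(f(a),a) : a\in A\}\cup\{(a_1,a_2)\in A\times A : f(a_1)=f(a_2)\}$$ is a definable equivalence relation on $X\amalg Y$ (where $\Delta$ denotes the diagonal), and there is a definable proper quotient of $X\amalg Y$ by $E(f)$. -/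

import Mathlib

namespace DefinableQuotient

universe u v w

/-- Definable means definable in the given structure with arbitrary parameters. -/
def IsDefinable (L : FirstOrder.Language.{u, v}) {F : Type w} [L.Structure F] {ι : Type*}
    (S : Set (ι → F)) : Prop :=
  (Set.univ : Set F).Definable L S

/-- The `L`-structure on `F` expands the ordered field `F`: the order, the addition and the
multiplication of `F` are definable (in particular this holds if they are named by symbols of `L`;
the constants `0` and `1` are always definable, with parameters). -/
structure ExpandsOrderedField (L : FirstOrder.Language.{u, v}) (F : Type w) [Field F] [LinearOrder F]
    [L.Structure F] : Prop where
  lt : IsDefinable L {x : Fin 2 → F | x 0 < x 1}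
  add : IsDefinable L {x : Fin 3 → F | x 0 + x 1 = x 2}
  mul : IsDefinable L {x : Fin 3 → F | x 0 * x 1 = x 2}

/-- Every definable subset of `F` has a supremum and an infimum in `F ∪ {±∞}`. The supremum is
`+∞` for a set that is not bounded above and `-∞` for the empty set, so only nonempty sets that
are bounded above need a condition; likewise for infima. -/
def DefinablyComplete (L : FirstOrder.Language.{u, v}) (F : Type w) [LinearOrder F] [L.Structure F] : Prop :=
  ∀ S : Set F, IsDefinable L {x : Fin 1 → F | x 0 ∈ S} → S.Nonempty →
    (BddAbove S → ∃ a, IsLUB S a) ∧ (BddBelow S → ∃ a, IsGLB S a)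

/-- For every definable `S ⊆ F` and every point `a`, there is an open interval `(b, c)` containing
`a` such that `S ∩ (b, c)` is a finite union of points and open intervals. -/
def LocallyOMinimal (L : FirstOrder.Language.{u, v}) (F : Type w) [LinearOrder F] [L.Structure F] : Prop :=
  ∀ S : Set F, IsDefinable L {x : Fin 1 → F | x 0 ∈ S} → ∀ a : F,
    ∃ b c : F, a ∈ Set.Ioo b c ∧
      ∃ (P : Finset F) (J : Finset (F × F)),
        S ∩ Set.Ioo b c = (P : Set F) ∪ ⋃ j ∈ J, Set.Ioo j.1 j.2

/-- Boundedness in `F ^ n`, for the norm `|x| = max |x i|`. -/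
def IsBdd {F : Type w} [Field F] [LinearOrder F] {n : ℕ} (S : Set (Fin n → F)) : Prop :=
  ∃ r : F, ∀ x ∈ S, ∀ i, |x i| ≤ r

/-- The graph of a map between a subset of `F ^ m` and a subset of `F ^ n`, as a subset of
`F ^ (m + n)`. -/
def graph {F : Type w} {m n : ℕ} {X : Set (Fin m → F)} {Y : Set (Fin n → F)} (f : X → Y) :
    Set (Fin m ⊕ Fin n → F) :=
  {z | ∃ x : X, z = Sum.elim (x : Fin m → F) (f x : Fin n → F)}

/-- `X` and `Y` are definable sets and `f : X → Y` is a definable map (not necessarily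
continuous). -/
structure IsDefinableMap (L : FirstOrder.Language.{u, v}) {F : Type w} [L.Structure F] {m n : ℕ}
    {X : Set (Fin m → F)} {Y : Set (Fin n → F)} (f : X → Y) : Prop where
  dom : IsDefinable L X
  cod : IsDefinable L Y
  graph : IsDefinable L (graph f)

/-- A definable equivalence relation `E ⊆ X × X` on a definable set `X`. -/
structure IsDefinableEquivalence (L : FirstOrder.Language.{u, v}) {F : Type w} [L.Structure F] {m : ℕ}
    (X : Set (Fin m → F)) (E : Set (X × X)) : Prop where
  carrier : IsDefinable L X
  definable : IsDefinable L
    {z : Fin m ⊕ Fin m → F | ∃ e ∈ E, z = Sum.elim (e.1 : Fin m → F) (e.2 : Fin m → F)}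
  equivalence : Equivalence fun x y : X => (x, y) ∈ E

section Topological

variable (L : FirstOrder.Language.{u, v}) {F : Type w} [Field F] [LinearOrder F] [TopologicalSpace F]
  [L.Structure F] {m n : ℕ} {X : Set (Fin m → F)} {Y : Set (Fin n → F)}

/-- A definable continuous map `f : X → Y` is definably proper if, for every closed bounded
definable `K ⊆ F ^ n` with `K ⊆ Y`, the inverse image of `K` is closed and bounded in `F ^ m`. -/
structure DefinablyProper (f : X → Y) : Prop where
  definable : IsDefinableMap L f
  continuous : Continuous f
  proper : ∀ K : Set (Fin n → F), IsDefinable L K → K ⊆ Y → IsClosed K → IsBdd K →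
    IsClosed {x : Fin m → F | ∃ hx : x ∈ X, (f ⟨x, hx⟩ : Fin n → F) ∈ K} ∧
      IsBdd {x : Fin m → F | ∃ hx : x ∈ X, (f ⟨x, hx⟩ : Fin n → F) ∈ K}

/-- A definable continuous map `f : X → Y` is definably identifying if it is surjective and every
definable `K ⊆ Y` whose inverse image is closed in `X` is closed in `Y`. -/
structure DefinablyIdentifying (f : X → Y) : Prop where
  definable : IsDefinableMap L f
  continuous : Continuous f
  surjective : Function.Surjective f
  identifying : ∀ K : Set (Fin n → F), IsDefinable L K → K ⊆ Y →
    IsClosed {x : X | (f x : Fin n → F) ∈ K} → IsClosed {y : Y | (y : Fin n → F) ∈ K}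

/-- `p : X → Y` is a definable quotient of the definable set `X` by the definable equivalence
relation `E`. -/
structure IsDefinableQuotient (E : Set (X × X)) (p : X → Y) : Prop where
  equivalence : IsDefinableEquivalence L X E
  identifying : DefinablyIdentifying L p
  eq_iff : ∀ x x' : X, p x = p x' ↔ (x, x') ∈ E

/-- A definable proper quotient is a definable quotient that is definably proper. -/
structure IsDefinableProperQuotient (E : Set (X × X)) (p : X → Y) : Prop where
  quotient : IsDefinableQuotient L E p
  proper : DefinablyProper L p

/-- `(h₁, h₂, T)` is a disjoint sum of the definable sets `X` and `Y`: each `hᵢ` is a definable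
homeomorphism onto its image, the images are open in the definable set `T`, and `T` is their
disjoint union. -/
structure IsDisjointSum {k : ℕ} {T : Set (Fin k → F)} (h₁ : X → T) (h₂ : Y → T) : Prop where
  definable_left : IsDefinableMap L h₁
  definable_right : IsDefinableMap L h₂
  embedding_left : Topology.IsEmbedding h₁
  embedding_right : Topology.IsEmbedding h₂
  isOpen_left : IsOpen (Set.range h₁)
  isOpen_right : IsOpen (Set.range h₂)
  disjoint : Disjoint (Set.range h₁) (Set.range h₂)
  union : Set.range h₁ ∪ Set.range h₂ = Set.univ

end Topological

/-- The relation `E(f)` on a disjoint sum `(h₁, h₂, T)` of `X` and `Y`, for `f : A → Y` with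
`A ⊆ X`:
`Δ(X) ∪ Δ(Y) ∪ {(a, f a)} ∪ {(f a, a)} ∪ {(a₁, a₂) | f a₁ = f a₂}`, where `X` and `Y` are
identified with their images in `T`. -/
def attachingRel {F : Type w} {m n k : ℕ} {X A : Set (Fin m → F)} {Y : Set (Fin n → F)}
    {T : Set (Fin k → F)} (h₁ : X → T) (h₂ : Y → T) (hAX : A ⊆ X) (f : A → Y) : Set (T × T) :=
  {e | ∃ x : X, e = (h₁ x, h₁ x)} ∪ {e | ∃ y : Y, e = (h₂ y, h₂ y)} ∪
    {e | ∃ a : A, e = (h₁ (Set.inclusion hAX a), h₂ (f a))} ∪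
    {e | ∃ a : A, e = (h₂ (f a), h₁ (Set.inclusion hAX a))} ∪
    {e | ∃ a₁ a₂ : A, f a₁ = f a₂ ∧
      e = (h₁ (Set.inclusion hAX a₁), h₁ (Set.inclusion hAX a₂))}

end DefinableQuotient

/-! The quotient is built explicitly inside `F ^ (n + (m + 1))`. Since `X` is locally closed, it
carries a continuous definable function `ρ` with closed bounded sublevel sets (`exists_exhaustion`),
which measures how far a point is from escaping `X`. Squash each coordinate of `f` into `(-2, -1)`
and extend the result to a continuous definable `G` on `X` (`exists_extension`). Let `d x` be the
infimum, truncated at `1`, of `|x - a| + |ρ x - ρ a| + |G x - squash (f a)|` over `a ∈ A`; on `X` it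
is continuous and vanishes exactly on `A`. Send `x ∈ X` to `P x = (G x, d x, d x • x)` and `y ∈ Y`
to `Q y = (squash y, 0, 0)` (`exists_gluing`). On `A` these satisfy `P a = Q (f a)`; off `A` the
middle coordinate is nonzero and division by it recovers `x`. Hence the fibres of the combined map
are exactly the classes of `E(f)`.

For the topology it is enough that `ρ` stays bounded on the part of `X` that `P` sends near a given
point of the image. Near `P x₀` with `x₀ ∉ A` this follows by division. Near `Q y`, a small `d x`
supplies `a ∈ A` with `f a` near `y` and `ρ a` near `ρ x`, so one needs a neighbourhood of `y` over
which `ρ` is bounded on `A`. This is `IsExhaustion.locally_bounded`, where the properness of `f`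
enters. If it failed, the points where `|f a - y|` attains a new minimum as `ρ` grows would form a
set `B` such that `{y} ∪ f(B)` is closed, bounded and contained in `Y`, while `ρ` is unbounded on
its inverse image.

Compactness is replaced by a cluster point principle for definable families (`exists_cluster`),
which needs only suprema of definable sets. It gives minima of continuous definable functions and
closedness of continuous definable images of closed bounded sets. -/

namespace DefinableQuotient

universe u v w w₁ w₂ w₃

open Set

set_option linter.unusedSectionVars false

/-- A type whose elements are coded by finitely many coordinates in `F`. -/
class Coord (F : Type w) (α : Type w₁) where
  idx : Type
  finite : Finite idx
  equiv : α ≃ (idx → F)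

instance (F : Type w) (α : Type w₁) [Coord F α] : Finite (Coord.idx F α) := Coord.finite

instance Coord.self (F : Type w) : Coord F F := ⟨Unit, inferInstance, (Equiv.funUnique Unit F).symm⟩

instance Coord.pi (F : Type w) (ι : Type) [Finite ι] : Coord F (ι → F) :=
  ⟨ι, inferInstance, Equiv.refl _⟩

instance Coord.prod (F : Type w) (α : Type w₁) (β : Type w₂) [Coord F α] [Coord F β] :
    Coord F (α × β) :=
  ⟨Coord.idx F α ⊕ Coord.idx F β, inferInstance,
    (Equiv.prodCongr Coord.equiv Coord.equiv).trans (Equiv.sumArrowEquivProdArrow _ _ _).symm⟩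

/-! ### Calculus of definable predicates and maps -/

section Definability

variable (L : FirstOrder.Language.{u, v}) (F : Type w) [L.Structure F]
  {α : Type w₁} {β : Type w₂} {γ : Type w₃} [Coord F α] [Coord F β] [Coord F γ]

/-- A predicate is definable if it is so in coordinates. -/
@[fun_prop]
def Def (P : α → Prop) : Prop :=
  IsDefinable L {v : Coord.idx F α → F | P (Coord.equiv.symm v)}

/-- A map is definable if its graph is. -/
@[fun_prop]
def DefFun (t : α → β) : Prop := Def L F fun p : α × β => t p.1 = p.2

variable {L F}

@[fun_prop]
theorem Def.and {P Q : α → Prop} (hP : Def L F P) (hQ : Def L F Q) :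
    Def L F fun a => P a ∧ Q a := Set.Definable.inter hP hQ

@[fun_prop]
theorem Def.or {P Q : α → Prop} (hP : Def L F P) (hQ : Def L F Q) :
    Def L F fun a => P a ∨ Q a := Set.Definable.union hP hQ

@[fun_prop]
theorem Def.not {P : α → Prop} (hP : Def L F P) : Def L F fun a => ¬ P a :=
  Set.Definable.compl hP

@[fun_prop]
theorem Def.imp {P Q : α → Prop} (hP : Def L F P) (hQ : Def L F Q) :
    Def L F fun a => P a → Q a := by
  simp only [imp_iff_not_or]
  exact hP.not.or hQ

@[fun_prop]
theorem Def.const (p : Prop) : Def L F fun _ : α => p := by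
  by_cases h : p
  · simp [Def, IsDefinable, h]
  · simp [Def, IsDefinable, h]

theorem Def.reindex {P : β → Prop} (hP : Def L F P) {φ : α → β}
    (σ : Coord.idx F β → Coord.idx F α)
    (hσ : ∀ a j, Coord.equiv (F := F) (φ a) j = Coord.equiv (F := F) a (σ j)) :
    Def L F fun a => P (φ a) := by
  have := Set.Definable.preimage_comp σ hP
  refine (congrArg (Set.Definable _ L) ?_).mp this
  ext v
  simp only [mem_preimage, mem_ofPred_eq]
  rw [iff_iff_eq]
  congr 1
  rw [Equiv.symm_apply_eq]
  ext j
  simp [hσ]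

/-- In coordinates an existential quantifier is a projection, that is, restriction of tuples to the
left summand of the index type. -/
theorem Def.exists {P : α → β → Prop} (hP : Def L F fun p : α × β => P p.1 p.2) :
    Def L F fun a => ∃ b, P a b := by
  have := Set.Definable.image_comp hP (Sum.inl : _ → Coord.idx F α ⊕ Coord.idx F β)
  refine (congrArg (Set.Definable _ L) ?_).mp this
  ext v
  constructor
  · rintro ⟨w, hw, rfl⟩
    exact ⟨_, hw⟩
  · rintro ⟨b, hb⟩
    refine ⟨Sum.elim v (Coord.equiv b), ?_, rfl⟩
    have : (Coord.equiv (F := F) (α := α × β)).symm (Sum.elim v (Coord.equiv b)) =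
        (Coord.equiv.symm v, b) := by
      rw [Equiv.symm_apply_eq]
      ext (j | j) <;> simp [Coord.equiv]
    simp only [mem_ofPred_eq, this]
    exact hb

theorem Def.forall {P : α → β → Prop} (hP : Def L F fun p : α × β => P p.1 p.2) :
    Def L F fun a => ∀ b, P a b := by
  have : Def L F fun a => ¬ ∃ b, ¬ P a b := (Def.exists hP.not).not
  simpa using this

theorem Def.forall_finite {ι : Type*} [Finite ι] {P : ι → α → Prop} (hP : ∀ i, Def L F (P i)) :
    Def L F fun a => ∀ i, P i a := by
  have := Set.definable_iInter_of_finite hP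
  refine (congrArg (Set.Definable _ L) ?_).mp this
  ext v
  simp

theorem def_coord_eq (i j : Coord.idx F α) :
    Def L F fun a : α => Coord.equiv (F := F) a i = Coord.equiv (F := F) a j := by
  have : IsDefinable L {v : Coord.idx F α → F | v i = v j} :=
    ⟨(FirstOrder.Language.Term.var i).equal (FirstOrder.Language.Term.var j), by ext; simp⟩
  simpa [Def] using this

theorem def_coord_eq_const (i : Coord.idx F α) (c : F) :
    Def L F fun a : α => Coord.equiv (F := F) a i = c := by
  have : IsDefinable L {v : Coord.idx F α → F | v i = c} :=
    ⟨(FirstOrder.Language.Term.var i).equal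
      (FirstOrder.Language.Constants.term (L.con (⟨c, trivial⟩ : (univ : Set F)))), by ext; simp⟩
  simpa [Def] using this

theorem def_eq_self : Def L F fun p : α × α => p.1 = p.2 := by
  have : Def L F fun p : α × α => ∀ j : Coord.idx F α,
      Coord.equiv (F := F) p (Sum.inl j) = Coord.equiv (F := F) p (Sum.inr j) :=
    Def.forall_finite fun j => def_coord_eq (L := L) (F := F) (α := α × α) (Sum.inl j) (Sum.inr j)
  refine (congrArg (Def L F) ?_).mp this
  ext p
  rw [← funext_iff (f := fun j => Coord.equiv (F := F) p (Sum.inl j))]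
  exact (Coord.equiv (F := F) (α := α)).injective.eq_iff

theorem Def.swap_left {P : β → γ → Prop} (hP : Def L F fun p : β × γ => P p.1 p.2) :
    Def L F fun p : (α × γ) × β => P p.2 p.1.2 :=
  hP.reindex (φ := fun p : (α × γ) × β => (p.2, p.1.2))
    (Sum.elim Sum.inr fun k => Sum.inl (Sum.inr k)) (by rintro ⟨⟨a, c⟩, b⟩ (j | j) <;> rfl)

/-- Only the graph of `t` is known to be definable, so substitution goes through an intermediate
value: `∃ b, t a = b ∧ P b`. -/
theorem Def.comp {P : β → Prop} (hP : Def L F P) {t : α → β} (ht : DefFun L F t) :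
    Def L F fun a => P (t a) := by
  have : Def L F fun a => ∃ b, t a = b ∧ P b :=
    Def.exists (ht.and (hP.reindex (φ := Prod.snd) Sum.inr fun _ _ => rfl))
  simpa using this

@[fun_prop]
theorem DefFun.id : DefFun L F fun a : α => a := def_eq_self

@[fun_prop]
theorem DefFun.const (c : β) : DefFun L F fun _ : α => c := by
  have : Def L F fun b : β => ∀ j, Coord.equiv (F := F) b j = Coord.equiv (F := F) c j :=
    Def.forall_finite fun j => def_coord_eq_const j _
  have h := this.reindex (φ := (Prod.snd : α × β → β)) Sum.inr fun _ _ => rfl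
  refine (congrArg (Def L F) ?_).mp h
  ext p
  rw [← funext_iff, (Coord.equiv (F := F)).injective.eq_iff, eq_comm]

@[fun_prop]
theorem DefFun.comp {t : β → γ} {s : α → β} (ht : DefFun L F t) (hs : DefFun L F s) :
    DefFun L F fun a => t (s a) := by
  have : Def L F fun p : α × γ => ∃ b, s p.1 = b ∧ t b = p.2 := by
    refine Def.exists (Def.and ?_ (Def.swap_left (P := fun b c => t b = c) ht))
    exact Def.reindex (P := fun p : α × β => s p.1 = p.2) hs
      (φ := fun p : (α × γ) × β => (p.1.1, p.2))
      (Sum.elim (fun k => Sum.inl (Sum.inl k)) Sum.inr) (by rintro ⟨⟨a, c⟩, b⟩ (j | j) <;> rfl)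
  simpa [DefFun] using this

theorem DefFun.of_coords {φ : α → β} (σ : Coord.idx F β → Coord.idx F α)
    (hσ : ∀ a j, Coord.equiv (F := F) (φ a) j = Coord.equiv (F := F) a (σ j)) : DefFun L F φ :=
  Def.reindex (P := fun p : β × β => p.1 = p.2) def_eq_self (φ := fun p : α × β => (φ p.1, p.2))
    (Sum.map σ _root_.id) (by rintro ⟨a, b⟩ (j | j); exacts [hσ a j, rfl])

@[fun_prop]
theorem DefFun.fst {t : α → β × γ} (ht : DefFun L F t) : DefFun L F fun a => (t a).1 :=
  DefFun.comp (t := Prod.fst) (DefFun.of_coords Sum.inl fun _ _ => rfl) ht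

@[fun_prop]
theorem DefFun.snd {t : α → β × γ} (ht : DefFun L F t) : DefFun L F fun a => (t a).2 :=
  DefFun.comp (t := Prod.snd) (DefFun.of_coords Sum.inr fun _ _ => rfl) ht

@[fun_prop]
theorem DefFun.prodMk {t : α → β} {s : α → γ} (ht : DefFun L F t) (hs : DefFun L F s) :
    DefFun L F fun a => (t a, s a) := by
  have : Def L F fun p : α × (β × γ) => t p.1 = p.2.1 ∧ s p.1 = p.2.2 := by
    refine Def.and ?_ ?_
    · exact Def.comp (P := fun p : α × β => t p.1 = p.2) ht
        (t := fun p : α × (β × γ) => (p.1, p.2.1))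
        (.of_coords (Sum.elim Sum.inl (fun k => Sum.inr (Sum.inl k)))
          (by rintro ⟨a, b⟩ (j | j) <;> rfl))
    · exact Def.comp (P := fun p : α × γ => s p.1 = p.2) hs
        (t := fun p : α × (β × γ) => (p.1, p.2.2))
        (.of_coords (Sum.elim Sum.inl (fun k => Sum.inr (Sum.inr k)))
          (by rintro ⟨a, b⟩ (j | j) <;> rfl))
  simpa [DefFun, Prod.ext_iff] using this

@[fun_prop]
theorem Def.eq {t s : α → β} (ht : DefFun L F t) (hs : DefFun L F s) :
    Def L F fun a => t a = s a :=
  Def.comp (P := fun p : β × β => p.1 = p.2) def_eq_self (ht.prodMk hs)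

@[fun_prop]
theorem DefFun.apply {ι : Type} [Finite ι] (i : ι) : DefFun L F fun x : ι → F => x i :=
  DefFun.of_coords (fun _ => i) fun _ _ => rfl

@[fun_prop]
theorem DefFun.pi {ι : Type} [Finite ι] {t : α → ι → F} (ht : ∀ i, DefFun L F fun a => t a i) :
    DefFun L F t := by
  have : Def L F fun p : α × (ι → F) => ∀ i, t p.1 i = p.2 i :=
    Def.forall_finite fun i => Def.eq ((ht i).comp (DefFun.id.fst)) ((DefFun.apply i).comp DefFun.id.snd)
  simpa [DefFun, funext_iff] using this

theorem DefFun.ite {P : α → Prop} {t s : α → β} [DecidablePred P] (hP : Def L F P)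
    (ht : DefFun L F t) (hs : DefFun L F s) : DefFun L F fun a => if P a then t a else s a := by
  have : Def L F fun p : α × β => (P p.1 ∧ t p.1 = p.2) ∨ (¬ P p.1 ∧ s p.1 = p.2) :=
    ((hP.comp DefFun.id.fst).and ht).or ((hP.comp DefFun.id.fst).not.and hs)
  refine (congrArg (Def L F) ?_).mp this
  ext p
  by_cases h : P p.1 <;> simp [h]

end Definability

/-! ### Definability of the field operations -/

section OrderedField

variable {L : FirstOrder.Language.{u, v}} {F : Type w} [Field F] [LinearOrder F]
  [L.Structure F] [hF : Fact (ExpandsOrderedField L F)]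
  {α : Type w₁} {β : Type w₂} [Coord F α] [Coord F β]

@[fun_prop]
theorem Def.lt {t s : α → F} (ht : DefFun L F t) (hs : DefFun L F s) :
    Def L F fun a => t a < s a := by
  refine Def.comp (P := fun x : Fin 2 → F => x 0 < x 1) hF.out.lt (t := fun a => ![t a, s a]) ?_
  exact DefFun.pi fun i => by fin_cases i <;> assumption

@[fun_prop]
theorem Def.le {t s : α → F} (ht : DefFun L F t) (hs : DefFun L F s) :
    Def L F fun a => t a ≤ s a := by
  simpa using (Def.lt hs ht).not

@[fun_prop]
theorem DefFun.add {t s : α → F} (ht : DefFun L F t) (hs : DefFun L F s) :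
    DefFun L F fun a => t a + s a := by
  refine Def.comp (P := fun x : Fin 3 → F => x 0 + x 1 = x 2) hF.out.add
    (t := fun p : α × F => ![t p.1, s p.1, p.2]) ?_
  exact DefFun.pi fun i => by fin_cases i <;> simp <;> fun_prop

@[fun_prop]
theorem DefFun.mul {t s : α → F} (ht : DefFun L F t) (hs : DefFun L F s) :
    DefFun L F fun a => t a * s a := by
  refine Def.comp (P := fun x : Fin 3 → F => x 0 * x 1 = x 2) hF.out.mul
    (t := fun p : α × F => ![t p.1, s p.1, p.2]) ?_
  exact DefFun.pi fun i => by fin_cases i <;> simp <;> fun_prop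

@[fun_prop]
theorem DefFun.neg {t : α → F} (ht : DefFun L F t) : DefFun L F fun a => - t a := by
  simpa using (DefFun.const (-1 : F)).mul ht

@[fun_prop]
theorem DefFun.sub {t s : α → F} (ht : DefFun L F t) (hs : DefFun L F s) :
    DefFun L F fun a => t a - s a := by
  simpa [sub_eq_add_neg] using ht.add hs.neg

@[fun_prop]
theorem DefFun.inv {t : α → F} (ht : DefFun L F t) : DefFun L F fun a => (t a)⁻¹ := by
  -- The first disjunct accounts for the convention `0⁻¹ = 0`.
  have : Def L F fun p : α × F => (t p.1 = 0 ∧ p.2 = 0) ∨ t p.1 * p.2 = 1 := by fun_prop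
  refine (congrArg (Def L F) ?_).mp this
  ext ⟨a, b⟩
  by_cases h : t a = 0
  · simp [h, eq_comm]
  · simp [h, mul_eq_one_iff_inv_eq₀]

@[fun_prop]
theorem DefFun.div {t s : α → F} (ht : DefFun L F t) (hs : DefFun L F s) :
    DefFun L F fun a => t a / s a := by
  simpa [div_eq_mul_inv] using ht.mul hs.inv

@[fun_prop]
theorem DefFun.abs [IsStrictOrderedRing F] {t : α → F} (ht : DefFun L F t) :
    DefFun L F fun a => |t a| := by
  have : Def L F fun p : α × F => (0 ≤ t p.1 ∧ t p.1 = p.2) ∨ (t p.1 < 0 ∧ - t p.1 = p.2) := by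
    fun_prop
  refine (congrArg (Def L F) ?_).mp this
  ext ⟨a, b⟩
  rcases le_or_gt 0 (t a) with h | h
  · simp [h, abs_of_nonneg h, not_lt.mpr h]
  · simp [h, abs_of_neg h, not_le.mpr h]

@[fun_prop]
theorem DefFun.sum {ι : Type} (s : Finset ι) {t : ι → α → F} (ht : ∀ i, DefFun L F (t i)) :
    DefFun L F fun a => ∑ i ∈ s, t i a := by
  classical
  induction s using Finset.induction_on with
  | empty => simpa using DefFun.const (0 : F)
  | insert i s hi ih => simpa [Finset.sum_insert hi] using (ht i).add ih

end OrderedField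

/-! ### An `F`-valued metric inducing the product topology -/

section Distance

variable {F : Type w} [Field F] [LinearOrder F] [IsStrictOrderedRing F] {n : ℕ}

/-- The distance `∑ |x i - y i|` on `F ^ n`. -/
def sumDist (x y : Fin n → F) : F := ∑ i, |x i - y i|

theorem sumDist_nonneg (x y : Fin n → F) : 0 ≤ sumDist x y :=
  Finset.sum_nonneg fun _ _ => abs_nonneg _

@[simp]
theorem sumDist_self (x : Fin n → F) : sumDist x x = 0 := by simp [sumDist]

theorem sumDist_comm (x y : Fin n → F) : sumDist x y = sumDist y x := by
  simp [sumDist, abs_sub_comm]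

theorem sumDist_triangle (x y z : Fin n → F) : sumDist x z ≤ sumDist x y + sumDist y z := by
  rw [sumDist, sumDist, sumDist, ← Finset.sum_add_distrib]
  exact Finset.sum_le_sum fun i _ => abs_sub_le _ _ _

theorem abs_sub_le_sumDist (x y : Fin n → F) (i : Fin n) : |x i - y i| ≤ sumDist x y :=
  Finset.single_le_sum (f := fun i => |x i - y i|) (fun _ _ => abs_nonneg _) (Finset.mem_univ i)

theorem abs_sumDist_sub_le (x y z : Fin n → F) : |sumDist x z - sumDist y z| ≤ sumDist x y := by
  have h₁ := sumDist_triangle x y z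
  have h₂ := sumDist_triangle y x z
  rw [sumDist_comm y x] at h₂
  rw [abs_le]
  constructor <;> linarith

theorem eq_of_sumDist_le_zero {x y : Fin n → F} (h : sumDist x y ≤ 0) : x = y := by
  ext i
  have := (abs_sub_le_sumDist x y i).trans h
  exact sub_eq_zero.mp (abs_eq_zero.mp (le_antisymm this (abs_nonneg _)))

theorem sumDist_pos {x y : Fin n → F} (h : x ≠ y) : 0 < sumDist x y :=
  lt_of_not_ge fun h' => h (eq_of_sumDist_le_zero h')

theorem isBdd_of_sumDist_le {S : Set (Fin n → F)} (y : Fin n → F) (r : F)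
    (h : ∀ x ∈ S, sumDist x y ≤ r) : IsBdd S := by
  refine ⟨r + sumDist y 0, fun x hx i => ?_⟩
  have h₁ := abs_sub_le_sumDist x 0 i
  have h₂ := sumDist_triangle x y 0
  have h₃ := h x hx
  simp only [Pi.zero_apply, sub_zero] at h₁
  linarith

theorem IsBdd.union {S T : Set (Fin n → F)} (hS : IsBdd S) (hT : IsBdd T) : IsBdd (S ∪ T) := by
  obtain ⟨r, hr⟩ := hS
  obtain ⟨s, hs⟩ := hT
  refine ⟨max r s, ?_⟩
  rintro x (hx | hx) i
  · exact (hr x hx i).trans (le_max_left _ _)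
  · exact (hs x hx i).trans (le_max_right _ _)

theorem IsBdd.mono {S T : Set (Fin n → F)} (hT : IsBdd T) (h : S ⊆ T) : IsBdd S :=
  hT.imp fun _ hr x hx => hr x (h hx)

section Topology

variable [TopologicalSpace F] [OrderTopology F]

@[fun_prop]
theorem continuous_sumDist : Continuous fun p : (Fin n → F) × (Fin n → F) => sumDist p.1 p.2 := by
  unfold sumDist
  fun_prop

theorem _root_.ContinuousOn.sumDist {α : Type*} [TopologicalSpace α] {t s : α → Fin n → F}
    {S : Set α} (ht : ContinuousOn t S) (hs : ContinuousOn s S) :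
    ContinuousOn (fun a => sumDist (t a) (s a)) S := by
  unfold DefinableQuotient.sumDist
  exact continuousOn_finsetSum _ fun i _ =>
    ((continuousOn_pi.mp ht i).sub (continuousOn_pi.mp hs i)).abs

/-- `F` need not be archimedean, so real-valued metrics are replaced by this `F`-valued one. It also
turns closure and continuity into first-order conditions. -/
theorem nhds_basis_sumDist (x : Fin n → F) :
    (nhds x).HasBasis (fun ε : F => 0 < ε) fun ε => {y | sumDist y x < ε} := by
  refine ⟨fun U => ⟨fun hU => ?_, ?_⟩⟩
  · rw [nhds_pi, Filter.mem_pi] at hU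
    obtain ⟨I, -, V, hV, hVU⟩ := hU
    have : ∀ i, ∃ ε > 0, {b | |b - x i| < ε} ⊆ V i := fun i =>
      (nhds_basis_abs_sub_lt (x i)).mem_iff.mp (hV i)
    choose ε hε hεV using this
    obtain ⟨δ, hδ, hδε⟩ : ∃ δ > 0, ∀ i, δ ≤ ε i := by
      rcases isEmpty_or_nonempty (Fin n) with h | h
      · exact ⟨1, one_pos, fun i => h.elim i⟩
      · obtain ⟨i, hi⟩ := Finite.exists_min ε
        exact ⟨ε i, hε i, hi⟩
    refine ⟨δ, hδ, fun y hy => hVU fun i _ => hεV i ?_⟩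
    exact (abs_sub_le_sumDist y x i).trans_lt (lt_of_lt_of_le hy (hδε i))
  · rintro ⟨ε, hε, h⟩
    refine Filter.mem_of_superset ?_ h
    have : Continuous fun y : Fin n → F => sumDist y x :=
      continuous_sumDist.comp (continuous_id.prodMk continuous_const)
    exact (isOpen_Iio.preimage this).mem_nhds (by simpa using hε)

theorem mem_closure_iff_sumDist {S : Set (Fin n → F)} {x : Fin n → F} :
    x ∈ closure S ↔ ∀ ε > 0, ∃ y ∈ S, sumDist y x < ε := by
  exact mem_closure_iff_nhds_basis (nhds_basis_sumDist x)

theorem continuousOn_iff_sumDist_abs {g : (Fin n → F) → F} {S : Set (Fin n → F)} :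
    ContinuousOn g S ↔ ∀ x ∈ S, ∀ ε > 0, ∃ δ > 0, ∀ y ∈ S, sumDist y x < δ →
      |g y - g x| < ε := by
  refine forall₂_congr fun x hx => ?_
  rw [ContinuousWithinAt, ((nhdsWithin_hasBasis (nhds_basis_sumDist x) S)).tendsto_iff
    (nhds_basis_abs_sub_lt (g x))]
  refine forall₂_congr fun ε hε => exists_congr fun δ => and_congr_right fun _ => ?_
  exact ⟨fun h y hy hd => h y ⟨hd, hy⟩, fun h y hy => h y hy.2 hy.1⟩

end Topology

end Distance

/-! ### Definable infima depending on parameters -/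

section Infimum

variable {L : FirstOrder.Language.{u, v}} {F : Type w} [Field F] [LinearOrder F]
  [IsStrictOrderedRing F] [L.Structure F] [hF : Fact (ExpandsOrderedField L F)]
  {α : Type w₁} {β : Type w₂} [Coord F α] [Coord F β]

@[fun_prop]
theorem DefFun.sumDist {n : ℕ} {t s : α → Fin n → F} (ht : DefFun L F t) (hs : DefFun L F s) :
    DefFun L F fun a => sumDist (t a) (s a) := by
  unfold DefinableQuotient.sumDist
  fun_prop

theorem DefinablyComplete.exists_isGLB (hc : DefinablyComplete L F) {S : Set F}
    (hS : Def L F (· ∈ S)) (hne : S.Nonempty) (hb : BddBelow S) : ∃ a, IsGLB S a :=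
  (hc S (hS.comp (t := fun x : Fin 1 → F => x 0) (by fun_prop)) hne).2 hb

theorem DefinablyComplete.exists_isLUB (hc : DefinablyComplete L F) {S : Set F}
    (hS : Def L F (· ∈ S)) (hne : S.Nonempty) (hb : BddAbove S) : ∃ a, IsLUB S a :=
  (hc S (hS.comp (t := fun x : Fin 1 → F => x 0) (by fun_prop)) hne).1 hb

/-- The infimum of `b` and the values of `h` on `A`, or `0` if there is none. -/
noncomputable def infWith (A : Set β) (b : F) (h : β → F) : F :=
  open Classical in
  if H : ∃ c, IsGLB {t | t = b ∨ ∃ a ∈ A, t = h a} c then H.choose else 0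

theorem isGLB_infWith (hc : DefinablyComplete L F) {A : Set β} (hA : Def L F (· ∈ A)) {b : F}
    {h : β → F} (hh : DefFun L F h) {l : F} (hl : ∀ a ∈ A, l ≤ h a) :
    IsGLB {t | t = b ∨ ∃ a ∈ A, t = h a} (infWith A b h) := by
  have H : ∃ c, IsGLB {t | t = b ∨ ∃ a ∈ A, t = h a} c := by
    refine hc.exists_isGLB ?_ ⟨b, Or.inl rfl⟩ ⟨min b l, ?_⟩
    · refine Def.or (by fun_prop) (Def.exists (Def.and (hA.comp ?_) ?_)) <;> fun_prop
    · rintro t (rfl | ⟨a, ha, rfl⟩)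
      · exact min_le_left _ _
      · exact (min_le_right _ _).trans (hl a ha)
  rw [infWith, dif_pos H]
  exact H.choose_spec

/-- Being a greatest lower bound is a first-order condition, and so is the absence of one. The graph
is therefore definable even where the default value `0` is taken, and no completeness is required.
-/
theorem DefFun.infWith {A : Set β} (hA : Def L F (· ∈ A)) (b : F) {h : α → β → F}
    (hh : DefFun L F fun p : α × β => h p.1 p.2) :
    DefFun L F fun x => infWith A b (h x) := by
  have hS : Def L F fun p : α × F => p.2 = b ∨ ∃ a ∈ A, p.2 = h p.1 a := by
    refine Def.or (by fun_prop) (Def.exists (Def.and (hA.comp ?_) (Def.eq ?_ ?_)))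
    · fun_prop
    · fun_prop
    · exact hh.comp (s := fun p : (α × F) × β => (p.1.1, p.2)) (by fun_prop)
  have hG : Def L F fun p : α × F => IsGLB {t | t = b ∨ ∃ a ∈ A, t = h p.1 a} p.2 := by
    have : Def L F fun p : α × F =>
        (∀ t, (t = b ∨ ∃ a ∈ A, t = h p.1 a) → p.2 ≤ t) ∧
          ∀ s, (∀ t, (t = b ∨ ∃ a ∈ A, t = h p.1 a) → s ≤ t) → s ≤ p.2 := by
      refine Def.and (Def.forall (Def.imp ?_ ?_))
        (Def.forall (Def.imp (Def.forall (Def.imp ?_ ?_)) ?_))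
      · exact hS.comp (t := fun q : (α × F) × F => (q.1.1, q.2)) (by fun_prop)
      · fun_prop
      · exact hS.comp (t := fun q : ((α × F) × F) × F => (q.1.1.1, q.2)) (by fun_prop)
      · fun_prop
      · fun_prop
    exact this
  have : Def L F fun p : α × F => IsGLB {t | t = b ∨ ∃ a ∈ A, t = h p.1 a} p.2 ∨
      (¬ ∃ c, IsGLB {t | t = b ∨ ∃ a ∈ A, t = h p.1 a} c) ∧ p.2 = 0 := by
    refine hG.or (Def.and (Def.not (Def.exists ?_)) (by fun_prop))
    exact hG.comp (t := fun q : (α × F) × F => (q.1.1, q.2)) (by fun_prop)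
  refine (congrArg (Def L F) ?_).mp this
  ext ⟨x, c⟩
  simp only [DefinableQuotient.infWith]
  split_ifs with H
  · simp only [H, not_true_eq_false, false_and, or_false]
    exact ⟨fun h => H.choose_spec.unique h, fun h => h ▸ H.choose_spec⟩
  · have : ¬ IsGLB {t | t = b ∨ ∃ a ∈ A, t = h x a} c := fun h' => H ⟨c, h'⟩
    simp only [this, H, not_false_eq_true, true_and, false_or]
    exact eq_comm

section Bounds

variable {A : Set β} {b : F} {h h' : β → F}

theorem infWith_le_base (H : IsGLB {t | t = b ∨ ∃ a ∈ A, t = h a} (infWith A b h)) :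
    infWith A b h ≤ b := H.1 (Or.inl rfl)

theorem infWith_le (H : IsGLB {t | t = b ∨ ∃ a ∈ A, t = h a} (infWith A b h)) {a : β}
    (ha : a ∈ A) : infWith A b h ≤ h a := H.1 (Or.inr ⟨a, ha, rfl⟩)

theorem le_infWith (H : IsGLB {t | t = b ∨ ∃ a ∈ A, t = h a} (infWith A b h)) {c : F}
    (hb : c ≤ b) (hc : ∀ a ∈ A, c ≤ h a) : c ≤ infWith A b h := by
  refine H.2 ?_
  rintro t (rfl | ⟨a, ha, rfl⟩)
  exacts [hb, hc a ha]

theorem exists_lt_of_infWith_lt (H : IsGLB {t | t = b ∨ ∃ a ∈ A, t = h a} (infWith A b h)) {c : F}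
    (hc : infWith A b h < c) (hb : c ≤ b) : ∃ a ∈ A, h a < c := by
  by_contra! hcon
  exact absurd (le_infWith H hb hcon) (not_le.mpr hc)

/-- Infima of uniformly close functions are equally close. The continuity of `distTo`, of `d`, and
of the extension off `A` comes from this. -/
theorem abs_infWith_sub_le (H : IsGLB {t | t = b ∨ ∃ a ∈ A, t = h a} (infWith A b h))
    (H' : IsGLB {t | t = b ∨ ∃ a ∈ A, t = h' a} (infWith A b h')) {M : F} (hM : 0 ≤ M)
    (hle : ∀ a ∈ A, |h a - h' a| ≤ M) : |infWith A b h - infWith A b h'| ≤ M := by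
  have h₁ : infWith A b h - M ≤ infWith A b h' := by
    refine le_infWith H' (by linarith [infWith_le_base H]) fun a ha => ?_
    linarith [infWith_le H ha, (abs_le.mp (hle a ha)).2]
  have h₂ : infWith A b h' - M ≤ infWith A b h := by
    refine le_infWith H (by linarith [infWith_le_base H']) fun a ha => ?_
    linarith [infWith_le H' ha, (abs_le.mp (hle a ha)).1]
  rw [abs_le]
  constructor <;> linarith

end Bounds

end Infimum

/-! ### Definable compactness of closed bounded sets -/

section Compactness

variable {L : FirstOrder.Language.{u, v}} {F : Type w} [Field F] [LinearOrder F]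
  [IsStrictOrderedRing F] [L.Structure F] [hF : Fact (ExpandsOrderedField L F)] {n : ℕ}

/-- The cluster point is found one coordinate at a time: once the first `j` are fixed, the next one
is a limit superior along those members of the family that are close in the earlier coordinates.
Working with a family indexed by `s → ∞` avoids selecting a definable sequence. -/
theorem exists_cluster_coords (hc : DefinablyComplete L F) {S : F → (Fin n → F) → Prop}
    (hS : Def L F fun p : F × (Fin n → F) => S p.1 p.2) {R : F}
    (hR : ∀ s x, S s x → ∀ i, |x i| ≤ R) (hfreq : ∀ r, ∃ s ≥ r, ∃ x, S s x) (j : ℕ) :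
    ∃ c : Fin n → F, ∀ r, ∀ ε > 0, ∃ s ≥ r, ∃ x, S s x ∧ ∀ i : Fin n, i.1 < j →
      |x i - c i| < ε := by
  induction j with
  | zero =>
    refine ⟨0, fun r ε _ => ?_⟩
    obtain ⟨s, hs, x, hx⟩ := hfreq r
    exact ⟨s, hs, x, hx, by simp⟩
  | succ j ih =>
    obtain ⟨c, hcl⟩ := ih
    by_cases hj : j < n
    swap
    · refine ⟨c, fun r ε hε => ?_⟩
      obtain ⟨s, hs, x, hx, hxc⟩ := hcl r ε hε
      exact ⟨s, hs, x, hx, fun i _ => hxc i (by omega)⟩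
    let k : Fin n := ⟨j, hj⟩
    -- The values that coordinate `k` exceeds for arbitrarily late points arbitrarily near `c` in
    -- the earlier coordinates; its supremum is the limit superior.
    let U : Set F := {t | ∀ r, ∀ ε, 0 < ε → ∃ s, r ≤ s ∧ ∃ x, S s x ∧
      (∀ i : Fin n, i.1 < j → |x i - c i| < ε) ∧ t < x k}
    have hU : Def L F (· ∈ U) := by
      refine Def.forall (Def.forall (Def.imp ?_ (Def.exists (Def.and ?_
        (Def.exists (Def.and ?_ (Def.and (Def.forall_finite fun i => Def.imp ?_ ?_) ?_)))))))
      · fun_prop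
      · fun_prop
      · exact hS.comp (t := fun q : (((F × F) × F) × F) × (Fin n → F) => (q.1.2, q.2))
          (by fun_prop)
      · fun_prop
      · fun_prop
      · fun_prop
    have hUne : U.Nonempty := by
      refine ⟨-R - 1, fun r ε hε => ?_⟩
      obtain ⟨s, hs, x, hx, hxc⟩ := hcl r ε hε
      exact ⟨s, hs, x, hx, hxc, by linarith [(abs_le.mp (hR s x hx k)).1]⟩
    have hUb : BddAbove U := by
      refine ⟨R, fun t ht => ?_⟩
      obtain ⟨s, _, x, hx, _, hlt⟩ := ht 0 1 one_pos
      linarith [(abs_le.mp (hR s x hx k)).2]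
    obtain ⟨b, hb⟩ := hc.exists_isLUB hU hUne hUb
    refine ⟨Function.update c k b, fun r ε hε => ?_⟩
    obtain ⟨t, htU, htb, -⟩ := hb.exists_between (show b - ε < b by linarith)
    -- Failure of membership gives `r₀` and `ε₀` beyond which coordinate `k` never exceeds `b + ε /
    -- 2`. Membership of `t > b - ε`, applied past these thresholds, gives the bound from the other
    -- side.
    have hnot : b + ε / 2 ∉ U := fun h => by linarith [hb.1 h]
    simp only [U, mem_ofPred_eq, not_forall] at hnot
    obtain ⟨r₀, ε₀, hε₀, hno⟩ := hnot
    obtain ⟨s, hs, x, hx, hxc, hlt⟩ := htU (max r r₀) (min ε ε₀) (lt_min hε hε₀)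
    refine ⟨s, (le_max_left _ _).trans hs, x, hx, fun i hi => ?_⟩
    rcases eq_or_ne i k with rfl | hik
    · have : ¬ b + ε / 2 < x k := fun h => hno ⟨s, (le_max_right _ _).trans hs, x, hx,
        fun i hi => (hxc i hi).trans_le (min_le_right _ _), h⟩
      rw [Function.update_self, abs_lt]
      constructor <;> linarith
    · rw [Function.update_of_ne hik]
      have : i.1 ≠ j := fun h => hik (Fin.ext h)
      exact (hxc i (by omega)).trans_le (min_le_left _ _)

variable [TopologicalSpace F] [OrderTopology F]

theorem exists_cluster (hc : DefinablyComplete L F) {C : Set (Fin n → F)} (hC : IsClosed C)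
    (hCb : IsBdd C) {S : F → (Fin n → F) → Prop}
    (hS : Def L F fun p : F × (Fin n → F) => S p.1 p.2) (hSC : ∀ s x, S s x → x ∈ C)
    (hfreq : ∀ r, ∃ s ≥ r, ∃ x, S s x) :
    ∃ c ∈ C, ∀ U ∈ nhdsWithin c C, ∀ r, ∃ s ≥ r, ∃ x ∈ U, S s x := by
  obtain ⟨R, hR⟩ := hCb
  obtain ⟨c, hcl⟩ := exists_cluster_coords hc hS (fun s x h => hR x (hSC s x h)) hfreq n
  have key : ∀ V ∈ nhds c, ∀ r, ∃ s ≥ r, ∃ x ∈ V, S s x := by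
    intro V hV r
    obtain ⟨ε, hε, hεV⟩ := (nhds_basis_sumDist c).mem_iff.mp hV
    -- A sum of `n` terms below `ε / (n + 1)` is below `ε`; the `+ 1` also covers `n = 0`.
    obtain ⟨s, hs, x, hx, hxc⟩ := hcl r (ε / (n + 1)) (by positivity)
    refine ⟨s, hs, x, hεV ?_, hx⟩
    have h : sumDist x c ≤ n * (ε / (n + 1)) := by
      have := Finset.sum_le_card_nsmul Finset.univ (fun i => |x i - c i|) (ε / (n + 1))
        fun i _ => (hxc i i.2).le
      simpa [sumDist] using this
    refine lt_of_le_of_lt h ?_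
    rw [mul_div_assoc', div_lt_iff₀ (by positivity)]
    linarith
  refine ⟨c, ?_, fun U hU r => ?_⟩
  · rw [← hC.closure_eq, mem_closure_iff_nhds]
    intro V hV
    obtain ⟨s, -, x, hxV, hx⟩ := key V hV 0
    exact ⟨x, hxV, hSC s x hx⟩
  · obtain ⟨V, hV, hVU⟩ := mem_nhdsWithin_iff_exists_mem_nhds_inter.mp hU
    obtain ⟨s, hs, x, hxV, hx⟩ := key V hV r
    exact ⟨s, hs, x, hVU ⟨hxV, hSC s x hx⟩, hx⟩

/-- Otherwise the sets `{x ∈ C | h x < -s}` are all nonempty and cluster at some `c ∈ C`, where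
continuity bounds `h` below by `h c - 1`. -/
theorem exists_lower_bound (hc : DefinablyComplete L F) {C : Set (Fin n → F)} (hC : IsClosed C)
    (hCb : IsBdd C) (hCd : Def L F (· ∈ C)) {h : (Fin n → F) → F} (hh : DefFun L F h)
    (hcont : ContinuousOn h C) : ∃ r, ∀ x ∈ C, r ≤ h x := by
  by_contra! hcon
  obtain ⟨c, hcC, hcl⟩ := exists_cluster hc hC hCb (S := fun s x => x ∈ C ∧ h x < - s)
    (Def.and (hCd.comp (by fun_prop)) (by fun_prop)) (fun s x hx => hx.1)
    (fun r => ⟨r, le_rfl, hcon (-r)⟩)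
  obtain ⟨s, hs, x, hxU, hx⟩ := hcl _ (hcont c hcC (Ioi_mem_nhds (sub_one_lt (h c)))) (1 - h c)
  have : h c - 1 < h x := hxU
  linarith [hx.2]

theorem exists_upper_bound (hc : DefinablyComplete L F) {C : Set (Fin n → F)} (hC : IsClosed C)
    (hCb : IsBdd C) (hCd : Def L F (· ∈ C)) {h : (Fin n → F) → F} (hh : DefFun L F h)
    (hcont : ContinuousOn h C) : ∃ r, ∀ x ∈ C, h x ≤ r := by
  obtain ⟨r, hr⟩ := exists_lower_bound hc hC hCb hCd hh.neg hcont.neg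
  exact ⟨-r, fun x hx => by linarith [hr x hx]⟩

theorem exists_minimum (hc : DefinablyComplete L F) {C : Set (Fin n → F)} (hC : IsClosed C)
    (hCb : IsBdd C) (hCd : Def L F (· ∈ C)) (hne : C.Nonempty) {h : (Fin n → F) → F}
    (hh : DefFun L F h) (hcont : ContinuousOn h C) : ∃ c ∈ C, ∀ x ∈ C, h c ≤ h x := by
  obtain ⟨l, hl⟩ := exists_lower_bound hc hC hCb hCd hh hcont
  obtain ⟨m, hm⟩ := hc.exists_isGLB (S := h '' C)
    (Def.exists (Def.and (hCd.comp (by fun_prop)) (by fun_prop))) (hne.image h)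
    ⟨l, by rintro _ ⟨x, hx, rfl⟩; exact hl x hx⟩
  obtain ⟨c, hcC, hcl⟩ := exists_cluster hc hC hCb
    -- For `s > 0` this says `h x < m + 1 / s`, so the family consists of almost minimal points.
    (S := fun s x => x ∈ C ∧ (0 < s → (h x - m) * s < 1))
    (Def.and (hCd.comp (by fun_prop)) (by fun_prop)) (fun s x hx => hx.1)
    (fun r => by
      have hpos : 0 < max r 1 := lt_of_lt_of_le one_pos (le_max_right _ _)
      obtain ⟨_, ⟨x, hx, rfl⟩, -, hlt⟩ :=
        hm.exists_between (show m < m + (max r 1)⁻¹ by linarith [inv_pos.mpr hpos])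
      refine ⟨max r 1, le_max_left _ _, x, hx, fun _ => ?_⟩
      rw [← lt_div_iff₀ hpos, one_div]
      linarith)
  refine ⟨c, hcC, fun x hx => le_trans ?_ (hm.1 ⟨x, hx, rfl⟩)⟩
  by_contra! hlt
  -- Near `c` the excess over `m` stays above half of `h c - m`, while for `s ≥ 2 / (h c - m)` it is
  -- below `1 / s`, at most that half.
  obtain ⟨s, hs, y, hyU, hyC, hy⟩ := hcl _ (hcont c hcC
    (Ioi_mem_nhds (show h c - (h c - m) / 2 < h c by linarith))) (2 / (h c - m))
  have h₁ : h c - (h c - m) / 2 < h y := hyU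
  have h₂ : 0 < 2 / (h c - m) := div_pos two_pos (by linarith)
  have h₃ := hy (h₂.trans_le hs)
  have h₄ : 2 ≤ s * (h c - m) := (div_le_iff₀ (by linarith)).mp hs
  nlinarith [h₂.trans_le hs]

/-- For `z` in the closure of the image, the distance from `g x` to `z` attains its minimum on `C`,
and that minimum must be `0`. -/
theorem isClosed_image_of_isBdd (hc : DefinablyComplete L F) {k : ℕ} {C : Set (Fin n → F)}
    (hC : IsClosed C) (hCb : IsBdd C) (hCd : Def L F (· ∈ C)) {g : (Fin n → F) → (Fin k → F)}
    (hg : DefFun L F g) (hcont : ContinuousOn g C) : IsClosed (g '' C) := by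
  refine isClosed_of_closure_subset fun z hz => ?_
  rw [mem_closure_iff_sumDist] at hz
  rcases C.eq_empty_or_nonempty with rfl | hne
  · obtain ⟨_, ⟨x, hx, -⟩, -⟩ := hz 1 one_pos
    exact hx.elim
  have hd : ContinuousOn (fun x => sumDist (g x) z) C :=
    hcont.sumDist continuousOn_const
  obtain ⟨c, hcC, hmin⟩ := exists_minimum hc hC hCb hCd hne (h := fun x => sumDist (g x) z)
    (hg.sumDist (.const z)) hd
  refine ⟨c, hcC, eq_of_sumDist_le_zero ?_⟩
  by_contra! hpos
  obtain ⟨_, ⟨x, hx, rfl⟩, hlt⟩ := hz _ hpos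
  exact absurd (hmin x hx) (not_le.mpr hlt)

theorem isBdd_image_of_isClosed (hc : DefinablyComplete L F) {k : ℕ} {C : Set (Fin n → F)}
    (hC : IsClosed C) (hCb : IsBdd C) (hCd : Def L F (· ∈ C)) {g : (Fin n → F) → (Fin k → F)}
    (hg : DefFun L F g) (hcont : ContinuousOn g C) : IsBdd (g '' C) := by
  obtain ⟨r, hr⟩ := exists_upper_bound hc hC hCb hCd (h := fun x => sumDist (g x) 0)
    (hg.sumDist (.const 0)) (hcont.sumDist continuousOn_const)
  exact isBdd_of_sumDist_le 0 r (by rintro _ ⟨x, hx, rfl⟩; exact hr x hx)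

end Compactness

/-! ### Exhaustions, extension, and local boundedness of proper maps -/

section Construction

variable {L : FirstOrder.Language.{u, v}} {F : Type w} [Field F] [LinearOrder F]
  [IsStrictOrderedRing F] [L.Structure F] [hF : Fact (ExpandsOrderedField L F)] {m n : ℕ}

theorem abs_sub_le_iff_of_bounds {a b ε : F} (h₁ : b - ε ≤ a) (h₂ : a ≤ b + ε) : |a - b| ≤ ε := by
  rw [abs_le]
  constructor <;> linarith

/-- The distance to `A`, truncated at `1`. -/
noncomputable def distTo (A : Set (Fin m → F)) (x : Fin m → F) : F := infWith A 1 (sumDist x)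

section DistTo

variable {A : Set (Fin m → F)}

theorem isGLB_distTo (hc : DefinablyComplete L F) (hA : Def L F (· ∈ A)) (x : Fin m → F) :
    IsGLB {t | t = 1 ∨ ∃ a ∈ A, t = sumDist x a} (distTo A x) :=
  isGLB_infWith hc hA ((DefFun.const x).sumDist .id) fun a _ => sumDist_nonneg x a

@[fun_prop]
theorem defFun_distTo (hA : Def L F (· ∈ A)) : DefFun L F (distTo A) :=
  DefFun.infWith hA 1 (h := sumDist) (by fun_prop)

theorem distTo_nonneg (hc : DefinablyComplete L F) (hA : Def L F (· ∈ A)) (x : Fin m → F) :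
    0 ≤ distTo A x :=
  le_infWith (isGLB_distTo hc hA x) zero_le_one fun a _ => sumDist_nonneg x a

theorem distTo_le (hc : DefinablyComplete L F) (hA : Def L F (· ∈ A)) (x : Fin m → F)
    {a : Fin m → F} (ha : a ∈ A) : distTo A x ≤ sumDist x a :=
  infWith_le (isGLB_distTo hc hA x) ha

theorem abs_distTo_sub_le (hc : DefinablyComplete L F) (hA : Def L F (· ∈ A)) (x y : Fin m → F) :
    |distTo A x - distTo A y| ≤ sumDist x y :=
  abs_infWith_sub_le (isGLB_distTo hc hA x) (isGLB_distTo hc hA y) (sumDist_nonneg x y)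
    fun a _ => abs_sumDist_sub_le x y a

variable [TopologicalSpace F] [OrderTopology F]

theorem continuous_distTo (hc : DefinablyComplete L F) (hA : Def L F (· ∈ A)) :
    Continuous (distTo A) := by
  rw [← continuousOn_univ, continuousOn_iff_sumDist_abs]
  exact fun x _ ε hε => ⟨ε, hε, fun y _ hy => (abs_distTo_sub_le hc hA y x).trans_lt hy⟩

theorem distTo_pos (hc : DefinablyComplete L F) (hA : Def L F (· ∈ A)) {x : Fin m → F}
    (hx : x ∉ closure A) : 0 < distTo A x := by
  rw [mem_closure_iff_sumDist] at hx
  push Not at hx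
  obtain ⟨ε, hε, h⟩ := hx
  refine (lt_min one_pos hε).trans_le (le_infWith (isGLB_distTo hc hA x) (min_le_left _ _) ?_)
  intro a ha
  rw [sumDist_comm]
  exact (min_le_right _ _).trans (h a ha)

end DistTo

variable [TopologicalSpace F] [OrderTopology F]

/-- A continuous definable function on `X` with closed bounded sublevel sets. -/
structure IsExhaustion (L : FirstOrder.Language.{u, v}) {F : Type w} [Field F] [LinearOrder F]
    [TopologicalSpace F] [L.Structure F] {m : ℕ} (X : Set (Fin m → F)) (ρ : (Fin m → F) → F) :
    Prop where
  def_mem : Def L F (· ∈ X)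
  defFun : DefFun L F ρ
  continuousOn : ContinuousOn ρ X
  isClosed : ∀ r, IsClosed {x | x ∈ X ∧ ρ x ≤ r}
  isBdd : ∀ r, IsBdd {x | x ∈ X ∧ ρ x ≤ r}

theorem Def.closure {X : Set (Fin m → F)} (hX : Def L F (· ∈ X)) : Def L F (· ∈ closure X) := by
  simp only [mem_closure_iff_sumDist]
  exact Def.forall (Def.imp (by fun_prop) (Def.exists (Def.and (hX.comp (by fun_prop))
    (by fun_prop))))

/-- The function is `|x| + 1 / dist(x, D)` with `D = closure X \ X`: the first term bounds the
sublevel sets, the second keeps them away from `D`. Local closedness of `X` means exactly that `D`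
is closed, so the denominator is positive on `X`. -/
theorem exists_exhaustion (hc : DefinablyComplete L F) {X : Set (Fin m → F)}
    (hX : Def L F (· ∈ X)) (hXlc : IsLocallyClosed X) : ∃ ρ, IsExhaustion L X ρ := by
  let D := closure X \ X
  have hD : Def L F (· ∈ D) := hX.closure.and hX.not
  have hDcl : IsClosed D := by
    have := hXlc.isOpen_coborder
    rwa [coborder, isOpen_compl_iff] at this
  have hpos : ∀ x ∈ X, 0 < distTo D x := fun x hx =>
    distTo_pos hc hD (by rw [hDcl.closure_eq]; exact fun h => h.2 hx)
  have hcont : ContinuousOn (fun x => sumDist x 0 + (distTo D x)⁻¹) X := by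
    refine (continuousOn_id.sumDist continuousOn_const).add ?_
    exact (continuous_distTo hc hD).continuousOn.inv₀ fun x hx => (hpos x hx).ne'
  have hinv : ∀ x, 0 ≤ (distTo D x)⁻¹ := fun x => inv_nonneg.mpr (distTo_nonneg hc hD x)
  refine ⟨fun x => sumDist x 0 + (distTo D x)⁻¹, hX,
    (DefFun.id.sumDist (.const 0)).add (defFun_distTo hD).inv, hcont, fun r => ?_, fun r =>
    isBdd_of_sumDist_le 0 r fun x hx => by linarith [hx.2, hinv x]⟩
  have hsub : {x | x ∈ X ∧ sumDist x 0 + (distTo D x)⁻¹ ≤ r} ⊆ X := fun x hx => hx.1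
  refine isClosed_of_closure_subset fun z hz => ?_
  have hzX : z ∈ X := by
    by_contra hzX
    have hzD : z ∈ D := ⟨closure_mono hsub hz, hzX⟩
    obtain ⟨y, ⟨hyX, hy⟩, hyz⟩ := mem_closure_iff_sumDist.mp hz (|r| + 1)⁻¹ (by positivity)
    have h₁ : distTo D y < (|r| + 1)⁻¹ := (distTo_le hc hD y hzD).trans_lt hyz
    have h₂ : |r| + 1 < (distTo D y)⁻¹ := (lt_inv_comm₀ (hpos y hyX) (by positivity)).mp h₁
    linarith [sumDist_nonneg y 0, le_abs_self r]
  refine ⟨hzX, ?_⟩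
  have := (hcont z hzX).mono hsub
  have hne := mem_closure_iff_nhdsWithin_neBot.mp hz
  exact le_of_tendsto this (Filter.eventually_of_mem self_mem_nhdsWithin fun x hx => hx.2)

/-- Definable extension of a continuous function with values in `[-2, -1]`. -/
theorem exists_extension (hc : DefinablyComplete L F) {X A : Set (Fin m → F)}
    (hA : Def L F (· ∈ A)) (hcl : ∀ x ∈ X, x ∈ closure A → x ∈ A) {c : (Fin m → F) → F}
    (hcd : DefFun L F c) (hcc : ContinuousOn c A) (hcb : ∀ a ∈ A, c a ∈ Icc (-2) (-1)) :
    ∃ G : (Fin m → F) → F, DefFun L F G ∧ ContinuousOn G X ∧ ∀ a ∈ A, G a = c a := by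
  classical
  -- A Riesz-type formula for the Tietze extension: off `A`, take the infimum of `c a * q x a`. As
  -- `c` is negative, terms with `a` almost nearest to `x`, where `q` is close to `1`, are favoured.
  let q : (Fin m → F) → (Fin m → F) → F := fun x a => distTo A x / sumDist x a
  have hq0 : ∀ x a, 0 ≤ q x a := fun x a => div_nonneg (distTo_nonneg hc hA x) (sumDist_nonneg x a)
  have hq1 : ∀ x, ∀ a ∈ A, q x a ≤ 1 := fun x a ha =>
    div_le_one_of_le₀ (distTo_le hc hA x ha) (sumDist_nonneg x a)
  have hqd : DefFun L F fun p : (Fin m → F) × (Fin m → F) => c p.2 * q p.1 p.2 :=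
    (hcd.comp DefFun.id.snd).mul (((defFun_distTo hA).comp DefFun.id.fst).div (by fun_prop))
  let I : (Fin m → F) → F := fun x => infWith A 0 fun a => c a * q x a
  have hI : ∀ x, IsGLB {t | t = 0 ∨ ∃ a ∈ A, t = c a * q x a} (I x) := fun x =>
    isGLB_infWith hc hA (hqd.comp (s := fun a => (x, a)) (by fun_prop)) (l := -2) fun a ha => by
      nlinarith [(hcb a ha).1, (hcb a ha).2, hq0 x a, hq1 x a ha]
  have hId : DefFun L F I := DefFun.infWith hA 0 hqd
  have hpos : ∀ x ∈ X, x ∉ A → 0 < distTo A x := fun x hx hxA =>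
    distTo_pos hc hA fun h => hxA (hcl x hx h)
  refine ⟨fun x => if x ∈ A then c x else I x, hcd.ite hA hId, ?_, fun a ha => if_pos ha⟩
  rw [continuousOn_iff_sumDist_abs]
  intro x hx ε hε
  by_cases hxA : x ∈ A
  · obtain ⟨δ, hδ, hcδ⟩ := continuousOn_iff_sumDist_abs.mp hcc x hxA (ε / 3) (by positivity)
    let κ := min 1 (ε / 6)
    have hκ : 0 < κ := lt_min one_pos (by positivity)
    refine ⟨min (δ / 4) (1 / 2), lt_min (by positivity) (by positivity), fun y hy hyx => ?_⟩
    have hyδ : sumDist y x < δ / 4 := hyx.trans_le (min_le_left _ _)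
    have hy2 : sumDist y x < 1 / 2 := hyx.trans_le (min_le_right _ _)
    by_cases hyA : y ∈ A
    · simp only [if_pos hxA, if_pos hyA]
      exact (hcδ y hyA (by linarith)).trans (by linarith)
    simp only [if_pos hxA, if_neg hyA]
    have hdpos := hpos y hy hyA
    have hdle : distTo A y ≤ sumDist y x := distTo_le hc hA y hxA
    refine (abs_sub_le_iff_of_bounds (ε := 2 * ε / 3) ?_ ?_).trans_lt (by linarith)
    · refine le_infWith (hI y) (by linarith [(hcb x hxA).2]) fun a ha => ?_
      obtain ⟨hca₁, hca₂⟩ := hcb a ha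
      -- For `a` near `x`, `c a * q y a ≥ c a`, which is close to `c x`. For `a` far away, `q y a ≤
      -- 1 / 2`, so the term is at least `-2 / 2 = -1 ≥ c x`; this is what the range `[-2, -1]` is
      -- for.
      rcases lt_or_ge (sumDist a x) δ with had | had
      · have := (abs_lt.mp (hcδ a ha had)).1
        nlinarith [hq1 y a ha]
      · have h₁ := sumDist_triangle a y x
        rw [sumDist_comm a y] at h₁
        have h₂ : q y a ≤ 1 / 2 := by
          rw [div_le_iff₀ (by linarith)]
          linarith
        nlinarith [(hcb x hxA).2, hq0 y a]
    · have hκ1 : κ ≤ 1 := min_le_left _ _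
      have hκε : κ ≤ ε / 6 := min_le_right _ _
      -- An almost nearest point `a` has `q y a ≥ 1 - κ` and lies within `δ` of `x`. The radius
      -- bound `1 / 2` keeps `(1 + κ) * distTo A y` below the truncation level `1`.
      obtain ⟨a, ha, hlt⟩ := exists_lt_of_infWith_lt (isGLB_distTo hc hA y)
        (c := (1 + κ) * distTo A y) (by change distTo A y < _; nlinarith) (by nlinarith)
      obtain ⟨hca₁, hca₂⟩ := hcb a ha
      have h₁ := sumDist_triangle a y x
      rw [sumDist_comm a y] at h₁
      have h₂ := (abs_lt.mp (hcδ a ha (by nlinarith))).2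
      have h₃ := infWith_le (hI y) ha
      have h₄ : 1 - κ ≤ q y a := by
        have hya : 0 < sumDist y a := hdpos.trans_le (distTo_le hc hA y ha)
        rw [le_div_iff₀ hya]
        have : (1 - κ) * sumDist y a ≤ (1 - κ) * ((1 + κ) * distTo A y) :=
          mul_le_mul_of_nonneg_left hlt.le (by linarith)
        nlinarith [mul_nonneg (mul_nonneg hκ.le hκ.le) hdpos.le]
      change I y ≤ _ at h₃
      nlinarith
  · have hdpos := hpos x hx hxA
    refine ⟨min (distTo A x) (distTo A x * ε / 8), lt_min hdpos (by positivity), fun y hy hyx => ?_⟩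
    have hyA : y ∉ A := fun h => by
      have := distTo_le hc hA x h
      rw [sumDist_comm] at this
      exact absurd (hyx.trans_le (min_le_left _ _)) (not_lt.mpr this)
    simp only [if_neg hxA, if_neg hyA]
    refine (abs_infWith_sub_le (hI y) (hI x) (M := ε / 2) (by positivity) fun a ha => ?_).trans_lt
      (by linarith)
    obtain ⟨hca₁, hca₂⟩ := hcb a ha
    have hxa := distTo_le hc hA x ha
    have hya := distTo_le hc hA y ha
    have hypos := hpos y hy hyA
    have h₁ := abs_le.mp (abs_distTo_sub_le hc hA y x)
    have h₂ := abs_le.mp (abs_sumDist_sub_le y x a)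
    have h₃ : sumDist y x < distTo A x * ε / 8 := hyx.trans_le (min_le_right _ _)
    have h₅ : |q y a - q x a| ≤ ε / 4 := by
      have hxa' : 0 < sumDist x a := hdpos.trans_le hxa
      have hya' : 0 < sumDist y a := hypos.trans_le hya
      have h₆ : q y a * sumDist y a = distTo A y := div_mul_cancel₀ _ hya'.ne'
      have h₇ : q x a * sumDist x a = distTo A x := div_mul_cancel₀ _ hxa'.ne'
      have h₈ : sumDist y x * 2 ≤ ε / 4 * sumDist x a := by nlinarith
      have h₉ : (q y a - q x a) * sumDist x a =
          (distTo A y - distTo A x) - q y a * (sumDist y a - sumDist x a) := by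
        rw [← h₆, ← h₇]; ring
      have h₀ : |(q y a - q x a) * sumDist x a| ≤ ε / 4 * sumDist x a := by
        rw [h₉]
        refine le_trans (abs_sub _ _) ?_
        rw [abs_mul, abs_of_nonneg (hq0 y a)]
        have := abs_sumDist_sub_le y x a
        have := abs_distTo_sub_le hc hA y x
        nlinarith [hq1 y a ha, hq0 y a, abs_nonneg (sumDist y a - sumDist x a)]
      rw [abs_mul, abs_of_pos hxa'] at h₀
      exact le_of_mul_le_mul_right h₀ hxa'
    rw [← mul_sub, abs_mul]
    have : |c a| ≤ 2 := abs_le.mpr ⟨hca₁, by linarith⟩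
    nlinarith [abs_nonneg (c a), abs_nonneg (q y a - q x a)]

theorem IsExhaustion.isClosed_inter {X B : Set (Fin m → F)} {ρ : (Fin m → F) → F}
    (hρ : IsExhaustion L X ρ) (hBX : B ⊆ X) (hB : ∀ x ∈ X, x ∈ closure B → x ∈ B) (r : F) :
    IsClosed {x | x ∈ B ∧ ρ x ≤ r} := by
  refine isClosed_of_closure_subset fun z hz => ?_
  have hzX : z ∈ X ∧ ρ z ≤ r := by
    have hsub : {x | x ∈ B ∧ ρ x ≤ r} ⊆ {x | x ∈ X ∧ ρ x ≤ r} := fun x hx => ⟨hBX hx.1, hx.2⟩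
    exact closure_minimal hsub (hρ.isClosed r) hz
  exact ⟨hB z hzX.1 (closure_mono (fun x hx => hx.1) hz), hzX.2⟩

theorem IsExhaustion.isBdd_inter {X B : Set (Fin m → F)} {ρ : (Fin m → F) → F}
    (hρ : IsExhaustion L X ρ) (hBX : B ⊆ X) (r : F) : IsBdd {x | x ∈ B ∧ ρ x ≤ r} :=
  (hρ.isBdd r).mono fun _ hx => ⟨hBX hx.1, hx.2⟩

/-- A definably proper map is locally bounded in the fibres. -/
theorem IsExhaustion.locally_bounded (hc : DefinablyComplete L F) {X A : Set (Fin m → F)}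
    {Y : Set (Fin n → F)} {ρ : (Fin m → F) → F} (hρ : IsExhaustion L X ρ) (hA : Def L F (· ∈ A))
    (hAX : A ⊆ X) (hcl : ∀ x ∈ X, x ∈ closure A → x ∈ A) {f : (Fin m → F) → (Fin n → F)}
    (hf : DefFun L F f) (hfc : ContinuousOn f A) (hfY : MapsTo f A Y)
    (hprop : ∀ K : Set (Fin n → F), IsDefinable L K → K ⊆ Y → IsClosed K → IsBdd K →
      IsClosed {x | x ∈ A ∧ f x ∈ K} ∧ IsBdd {x | x ∈ A ∧ f x ∈ K}) {y : Fin n → F} (hy : y ∈ Y) :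
    ∃ ε > 0, ∃ r, ∀ a ∈ A, sumDist (f a) y < ε → ρ a ≤ r := by
  by_contra! hcon
  have hρA : ContinuousOn ρ A := hρ.continuousOn.mono hAX
  have hbound : ∀ K : Set (Fin n → F), Def L F (· ∈ K) → K ⊆ Y → IsClosed K → IsBdd K →
      ∃ r, ∀ a ∈ A, f a ∈ K → ρ a ≤ r := by
    intro K hK hKY hKc hKb
    obtain ⟨h₁, h₂⟩ := hprop K hK hKY hKc hKb
    obtain ⟨r, hr⟩ := exists_upper_bound hc h₁ h₂ (hA.and (hK.comp hf)) hρ.defFun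
      (hρA.mono fun x hx => hx.1)
    exact ⟨r, fun a ha haK => hr a ⟨ha, haK⟩⟩
  -- The fibre over `y` lies in `ρ ≤ R`, so `N` below is positive wherever `ρ ≥ R + 1`.
  obtain ⟨R, hR⟩ := hbound {y} (by simpa using Def.eq (L := L) (F := F) .id (.const y))
    (by simpa using hy) isClosed_singleton
    (isBdd_of_sumDist_le y 0 (by rintro _ rfl; simp))
  let N : (Fin m → F) → F := fun a => sumDist (f a) y
  have hN : DefFun L F N := hf.sumDist (.const y)
  have hNc : ContinuousOn N A := hfc.sumDist continuousOn_const
  have hNpos : ∀ a ∈ A, R + 1 ≤ ρ a → 0 < N a := fun a ha hRa => by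
    refine sumDist_pos fun h => ?_
    linarith [hR a ha h]
  -- Record points: no point with smaller `ρ`, past `R + 1`, is mapped closer to `y`. The strict
  -- inequality `ρ b < ρ a` is an open condition on `a`, which makes `B` closed in `X`.
  let B : Set (Fin m → F) := {a | a ∈ A ∧ (R + 1 ≤ ρ a ∧ (N a ≤ 1 ∧
    ∀ b, b ∈ A → R + 1 ≤ ρ b → ρ b < ρ a → N a ≤ N b))}
  have hρd := hρ.defFun
  have hB : Def L F (· ∈ B) := by
    refine hA.and (Def.and (by fun_prop) (Def.and (by fun_prop) (Def.forall (Def.imp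
      (hA.comp (by fun_prop)) ?_))))
    fun_prop
  have hBA : B ⊆ A := fun a ha => ha.1
  have hBcl : ∀ x ∈ X, x ∈ closure B → x ∈ B := by
    intro x hx hxB
    have hxA := hcl x hx (closure_mono hBA hxB)
    have hne := mem_closure_iff_nhdsWithin_neBot.mp hxB
    have hρt := (hρA x hxA).mono hBA
    have hNt := (hNc x hxA).mono hBA
    have hev : ∀ᶠ a in nhdsWithin x B, a ∈ B := self_mem_nhdsWithin
    refine ⟨hxA, ge_of_tendsto hρt (hev.mono fun a ha => ha.2.1),
      le_of_tendsto hNt (hev.mono fun a ha => ha.2.2.1), fun b hb hRb hbx => ?_⟩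
    refine le_of_tendsto hNt ?_
    filter_upwards [hev, hρt (Ioi_mem_nhds hbx)] with a ha hba
    exact ha.2.2.2 b hb hRb hba
  have hexists : ∀ ε > 0, ∀ r, ∃ b ∈ A, R + 1 ≤ ρ b ∧ N b < ε ∧ r < ρ b := fun ε hε r => by
    obtain ⟨b, hb, hbε, hbr⟩ := hcon ε hε (max r (R + 1))
    exact ⟨b, hb, (le_max_right _ _).trans hbr.le, hbε, (le_max_left _ _).trans_lt hbr⟩
  have hKY : insert y (f '' B) ⊆ Y := by
    rintro z (rfl | ⟨a, ha, rfl⟩)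
    exacts [hy, hfY (hBA ha)]
  have hKcl : IsClosed (insert y (f '' B)) := by
    refine isClosed_of_closure_subset fun z hz => ?_
    by_cases hzy : z = y
    · exact Or.inl hzy
    have hpos := sumDist_pos hzy
    -- Records with `ρ` beyond `ρ b` have `N ≤ N b` and so stay away from `z`. Near `z` only the
    -- closed bounded piece `ρ ≤ ρ b` of `B` contributes, and its image is closed.
    obtain ⟨b, hb, hRb, hNb, -⟩ := hexists (sumDist z y / 2) (by positivity) 0
    have hcl' : IsClosed (f '' {x | x ∈ B ∧ ρ x ≤ ρ b}) :=
      isClosed_image_of_isBdd hc (hρ.isClosed_inter (hBA.trans hAX) hBcl (ρ b))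
        (hρ.isBdd_inter (hBA.trans hAX) (ρ b)) (hB.and (by fun_prop)) hf
        (hfc.mono fun x hx => hBA hx.1)
    have hzc : z ∈ f '' {x | x ∈ B ∧ ρ x ≤ ρ b} := by
      rw [← hcl'.closure_eq, mem_closure_iff_sumDist]
      intro ε hε
      obtain ⟨w, hw, hwz⟩ := mem_closure_iff_sumDist.mp hz (min ε (sumDist z y / 2))
        (lt_min hε (by positivity))
      have h₁ := hwz.trans_le (min_le_right _ _)
      have h₂ := sumDist_triangle z w y
      rw [sumDist_comm z w] at h₂
      rcases hw with rfl | ⟨a, ha, rfl⟩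
      · rw [sumDist_self] at h₂
        linarith
      · refine ⟨f a, ⟨a, ⟨ha, ?_⟩, rfl⟩, hwz.trans_le (min_le_left _ _)⟩
        by_contra! hlt
        have h₃ : sumDist (f a) y ≤ N b := ha.2.2.2 b hb hRb hlt
        linarith
    exact Or.inr (image_mono (fun x hx => hx.1) hzc)
  have hKb : IsBdd (insert y (f '' B)) := by
    refine isBdd_of_sumDist_le y 1 ?_
    rintro z (rfl | ⟨a, ha, rfl⟩)
    · simp
    · exact ha.2.2.1
  have hKd : Def L F (· ∈ insert y (f '' B)) :=
    Def.or (by fun_prop) (Def.exists (Def.and (hB.comp (by fun_prop)) (by fun_prop)))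
  obtain ⟨r, hr⟩ := hbound _ hKd hKY hKcl hKb
  obtain ⟨b₀, hb₀, hRb₀, -, hrb₀⟩ := hexists 1 one_pos r
  have hmin : ∀ s, ∀ b ∈ A, R + 1 ≤ ρ b → ρ b ≤ s → ∃ a ∈ A, R + 1 ≤ ρ a ∧ ρ a ≤ s ∧
      ∀ b ∈ A, R + 1 ≤ ρ b → ρ b ≤ s → N a ≤ N b := by
    intro s b hb hRb hbs
    have hcA : IsClosed {x | (x ∈ A ∧ R + 1 ≤ ρ x) ∧ ρ x ≤ s} := by
      refine hρ.isClosed_inter (B := {x | x ∈ A ∧ R + 1 ≤ ρ x}) (fun x hx => hAX hx.1) ?_ s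
      intro x hx hxB
      have hxA := hcl x hx (closure_mono (fun x hx => hx.1) hxB)
      have hne := mem_closure_iff_nhdsWithin_neBot.mp hxB
      have ht := (hρA x hxA).mono (s := {x | x ∈ A ∧ R + 1 ≤ ρ x}) fun x hx => hx.1
      exact ⟨hxA, ge_of_tendsto ht
        (Filter.eventually_of_mem self_mem_nhdsWithin fun a ha => ha.2)⟩
    obtain ⟨a, ⟨⟨ha, hRa⟩, has⟩, hamin⟩ := exists_minimum hc hcA
      ((hρ.isBdd_inter hAX s).mono fun x hx => ⟨hx.1.1, hx.2⟩)
      ((hA.and (by fun_prop)).and (by fun_prop)) ⟨b, ⟨hb, hRb⟩, hbs⟩ hN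
      (hNc.mono fun x hx => hx.1.1)
    exact ⟨a, ha, hRa, has, fun b hb hRb hbs => hamin b ⟨⟨hb, hRb⟩, hbs⟩⟩
  -- Properness bounds `ρ` by `r` on `B`, and `ρ b₀ > r`. A minimiser `a` of `N` over a larger range
  -- containing some `b` with `N b < N a₀` is a record, so `ρ a ≤ r < ρ b₀`. Then `N a₀ ≤ N a ≤ N b
  -- < N a₀`, a contradiction.
  obtain ⟨a₀, ha₀, hRa₀, -, hmin₀⟩ := hmin (ρ b₀) b₀ hb₀ hRb₀ le_rfl
  obtain ⟨b, hb, hRb, hNb, -⟩ := hexists (min 1 (N a₀)) (lt_min one_pos (hNpos a₀ ha₀ hRa₀)) 0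
  obtain ⟨a, ha, hRa, hab, hmina⟩ := hmin (ρ b) b hb hRb le_rfl
  have hNab := hmina b hb hRb le_rfl
  have haB : a ∈ B := ⟨ha, hRa, (hNab.trans_lt (hNb.trans_le (min_le_left _ _))).le,
    fun b' hb' hRb' hlt => hmina b' hb' hRb' (hlt.le.trans hab)⟩
  have h₁ := hr a ha (Or.inr ⟨a, haB, rfl⟩)
  have h₂ := hmin₀ a ha hRa (h₁.trans hrb₀.le)
  linarith [hNb.trans_le (min_le_right _ _)]

end Construction

/-! ### A bounded model of the line -/

section Squash

variable {L : FirstOrder.Language.{u, v}} {F : Type w} [Field F] [LinearOrder F]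
  [IsStrictOrderedRing F] [L.Structure F] [hF : Fact (ExpandsOrderedField L F)] {m n : ℕ}

/-- A homeomorphism of `F` onto the interval `(-2, -1)`. -/
def squash (t : F) : F := t / (2 * (1 + |t|)) - 3 / 2

/-- The inverse of `squash`. -/
def unsquash (s : F) : F := (2 * s + 3) / (1 - |2 * s + 3|)

theorem two_mul_squash_add (t : F) : 2 * squash t + 3 = t / (1 + |t|) := by
  have : 1 + |t| ≠ 0 := by positivity
  unfold squash
  field_simp
  ring

theorem one_sub_abs_squash (t : F) : 1 - |2 * squash t + 3| = (1 + |t|)⁻¹ := by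
  have h : 0 < 1 + |t| := by positivity
  rw [two_mul_squash_add, abs_div, abs_of_pos h]
  field_simp
  ring

theorem unsquash_squash (t : F) : unsquash (squash t) = t := by
  have : 1 + |t| ≠ 0 := by positivity
  rw [unsquash, one_sub_abs_squash, two_mul_squash_add]
  field_simp

theorem squash_mem_Icc (t : F) : squash t ∈ Icc (-2 : F) (-1) := by
  have h : 0 < 1 - |2 * squash t + 3| := by
    rw [one_sub_abs_squash]
    positivity
  have := abs_lt.mp (show |2 * squash t + 3| < 1 by linarith)
  constructor <;> linarith

@[fun_prop]
theorem defFun_squash : DefFun L F (squash : F → F) := by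
  unfold squash
  fun_prop

@[fun_prop]
theorem defFun_unsquash : DefFun L F (unsquash : F → F) := by
  unfold unsquash
  fun_prop

variable [TopologicalSpace F] [OrderTopology F]

theorem continuous_squash : Continuous (squash : F → F) := by
  unfold squash
  refine (continuous_id.div (by fun_prop) fun t => ?_).sub continuous_const
  positivity

theorem continuousAt_unsquash (t : F) : ContinuousAt (unsquash : F → F) (squash t) := by
  unfold unsquash
  refine ContinuousAt.div (by fun_prop) (by fun_prop) ?_
  rw [one_sub_abs_squash]
  positivity

end Squash

/-! ### Coordinates on the ambient space of the quotient -/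

section Join

variable {L : FirstOrder.Language.{u, v}} {F : Type w} [L.Structure F] {m n : ℕ}

/-- The point of `F ^ (n + (m + 1))` with coordinates `g`, `t` and `x`. -/
def join (g : Fin n → F) (t : F) (x : Fin m → F) : Fin (n + (m + 1)) → F :=
  Fin.append g (Fin.cons t x : Fin (m + 1) → F)

/-- The first part of the coordinates. -/
def joinFst (z : Fin (n + (m + 1)) → F) : Fin n → F := fun i => z (Fin.castAdd (m + 1) i)

/-- The middle coordinate. -/
def joinMid (z : Fin (n + (m + 1)) → F) : F := z (Fin.natAdd n 0)

/-- The last part of the coordinates. -/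
def joinLast (z : Fin (n + (m + 1)) → F) : Fin m → F := fun i => z (Fin.natAdd n i.succ)

@[simp]
theorem joinFst_join (g : Fin n → F) (t : F) (x : Fin m → F) : joinFst (join g t x) = g := by
  ext i; simp [joinFst, join]

@[simp]
theorem joinMid_join (g : Fin n → F) (t : F) (x : Fin m → F) : joinMid (join g t x) = t := by
  simp [joinMid, join]

@[simp]
theorem joinLast_join (g : Fin n → F) (t : F) (x : Fin m → F) : joinLast (join g t x) = x := by
  ext i; simp [joinLast, join]

theorem defFun_join {α : Type w₁} [Coord F α] {g : α → Fin n → F} {t : α → F} {x : α → Fin m → F}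
    (hg : DefFun L F g) (ht : DefFun L F t) (hx : DefFun L F x) :
    DefFun L F fun a => join (g a) (t a) (x a) := by
  refine DefFun.pi fun i => ?_
  refine Fin.addCases (fun i => ?_) (fun i => ?_) i
  · simp only [join, Fin.append_left]
    fun_prop
  · simp only [join, Fin.append_right]
    refine Fin.cases ?_ (fun i => ?_) i
    · simpa using ht
    · simp only [Fin.cons_succ]
      fun_prop

theorem sumDist_join [Field F] [LinearOrder F] (g g' : Fin n → F) (t t' : F) (x x' : Fin m → F) :
    sumDist (join g t x) (join g' t' x') = sumDist g g' + (|t - t'| + sumDist x x') := by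
  simp [sumDist, join, Fin.sum_univ_add, Fin.sum_univ_succ]

theorem continuousOn_join [TopologicalSpace F] {α : Type w₁} [TopologicalSpace α] {S : Set α}
    {g : α → Fin n → F} {t : α → F} {x : α → Fin m → F}
    (hg : ContinuousOn g S) (ht : ContinuousOn t S) (hx : ContinuousOn x S) :
    ContinuousOn (fun a => join (g a) (t a) (x a)) S := by
  refine continuousOn_pi.mpr fun i => ?_
  refine Fin.addCases (fun i => ?_) (fun i => ?_) i
  · simpa [join] using continuousOn_pi.mp hg i
  · simp only [join, Fin.append_right]
    refine Fin.cases ?_ (fun i => ?_) i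
    · simpa using ht
    · simpa using continuousOn_pi.mp hx i

theorem continuous_joinFst [TopologicalSpace F] :
    Continuous (joinFst : (Fin (n + (m + 1)) → F) → _) := by
  unfold joinFst; fun_prop

theorem continuous_joinMid [TopologicalSpace F] :
    Continuous (joinMid : (Fin (n + (m + 1)) → F) → F) := by
  unfold joinMid; fun_prop

theorem continuous_joinLast [TopologicalSpace F] :
    Continuous (joinLast : (Fin (n + (m + 1)) → F) → _) := by
  unfold joinLast; fun_prop

theorem defFun_joinFst : DefFun L F (joinFst : (Fin (n + (m + 1)) → F) → _) := by
  unfold joinFst; fun_prop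

theorem defFun_joinMid : DefFun L F (joinMid : (Fin (n + (m + 1)) → F) → F) := by
  unfold joinMid; fun_prop

end Join

/-! ### Construction of the gluing maps -/

section Gluing

variable {L : FirstOrder.Language.{u, v}} {F : Type w} [Field F] [LinearOrder F]
  [IsStrictOrderedRing F] [L.Structure F] [hF : Fact (ExpandsOrderedField L F)]
  [TopologicalSpace F] [OrderTopology F] {m n N : ℕ}

/-- Maps `P` on `X` and `Q` on `Y` that are glued along `f : A → Y`, with a continuous inverse `Γ` of
`Q` and an equation `e = 0` of the image of `Q`, such that `P` is proper over every point of its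
image and of that of `Q`. -/
structure IsGluing (L : FirstOrder.Language.{u, v}) {F : Type w} [Field F] [LinearOrder F]
    [TopologicalSpace F] [L.Structure F] {m n N : ℕ} (X A : Set (Fin m → F)) (Y : Set (Fin n → F))
    (f : (Fin m → F) → (Fin n → F)) (ρ : (Fin m → F) → F) (P : (Fin m → F) → (Fin N → F))
    (Q : (Fin n → F) → (Fin N → F)) (Γ : (Fin N → F) → (Fin n → F)) (e : (Fin N → F) → F) :
    Prop where
  defFun_left : DefFun L F P
  defFun_right : DefFun L F Q
  defFun_inv : DefFun L F Γ
  defFun_eqn : DefFun L F e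
  continuousOn_left : ContinuousOn P X
  continuous_right : Continuous Q
  continuousAt_inv : ∀ y, ContinuousAt Γ (Q y)
  continuous_eqn : Continuous e
  inv_right : ∀ y, Γ (Q y) = y
  eqn_right : ∀ y, e (Q y) = 0
  eqn_left : ∀ x ∈ X, x ∉ A → e (P x) ≠ 0
  left_of_mem : ∀ a ∈ A, P a = Q (f a)
  left_inj : ∀ x ∈ X, x ∉ A → ∀ x' ∈ X, x' ∉ A → P x = P x' → x = x'
  proper_right : ∀ y ∈ Y, ∃ ε > 0, ∃ r, ∀ x ∈ X, sumDist (P x) (Q y) < ε → ρ x ≤ r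
  proper_left : ∀ x₀ ∈ X, x₀ ∉ A → ∃ ε > 0, ∃ r, ∀ x ∈ X, sumDist (P x) (P x₀) < ε → ρ x ≤ r

theorem exists_gluing (hc : DefinablyComplete L F) {X A : Set (Fin m → F)}
    {Y : Set (Fin n → F)} {ρ : (Fin m → F) → F} (hρ : IsExhaustion L X ρ) (hA : Def L F (· ∈ A))
    (hAX : A ⊆ X) (hcl : ∀ x ∈ X, x ∈ closure A → x ∈ A) {f : (Fin m → F) → (Fin n → F)}
    (hf : DefFun L F f) (hfc : ContinuousOn f A) (hfY : MapsTo f A Y)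
    (hprop : ∀ K : Set (Fin n → F), IsDefinable L K → K ⊆ Y → IsClosed K → IsBdd K →
      IsClosed {x | x ∈ A ∧ f x ∈ K} ∧ IsBdd {x | x ∈ A ∧ f x ∈ K}) :
    ∃ (P : (Fin m → F) → (Fin (n + (m + 1)) → F)) (Q : (Fin n → F) → (Fin (n + (m + 1)) → F))
      (Γ : (Fin (n + (m + 1)) → F) → (Fin n → F)) (e : (Fin (n + (m + 1)) → F) → F),
      IsGluing L X A Y f ρ P Q Γ e := by
  have hG : ∀ i, ∃ G : (Fin m → F) → F, DefFun L F G ∧ ContinuousOn G X ∧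
      ∀ a ∈ A, G a = squash (f a i) := fun i =>
    exists_extension hc hA hcl (by fun_prop)
      (continuous_squash.comp_continuousOn (continuousOn_pi.mp hfc i)) fun a _ => squash_mem_Icc _
  choose G' hG'd hG'c hG'A using hG
  let G : (Fin m → F) → Fin n → F := fun x i => G' i x
  let sq : (Fin n → F) → Fin n → F := fun y i => squash (y i)
  have hGd : DefFun L F G := DefFun.pi hG'd
  have hGc : ContinuousOn G X := continuousOn_pi.mpr hG'c
  have hGA : ∀ a ∈ A, G a = sq (f a) := fun a ha => funext fun i => hG'A i a ha
  have hsqd : DefFun L F sq := by fun_prop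
  have hsqc : Continuous sq := continuous_pi fun i => continuous_squash.comp (continuous_apply i)
  -- Besides the distance, `h` records the change in `ρ` and in the squashed map, so that a small
  -- infimum over `a ∈ A` controls both at once.
  let h : (Fin m → F) → (Fin m → F) → F := fun x a =>
    sumDist x a + |ρ x - ρ a| + sumDist (G x) (sq (f a))
  have hρd := hρ.defFun
  have hhd : DefFun L F fun p : (Fin m → F) × (Fin m → F) => h p.1 p.2 :=
    DefFun.add (by fun_prop)
      ((hGd.comp DefFun.id.fst).sumDist (hsqd.comp (hf.comp DefFun.id.snd)))
  have hdist : ∀ x a, sumDist x a ≤ h x a := fun x a => by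
    have := abs_nonneg (ρ x - ρ a)
    have := sumDist_nonneg (G x) (sq (f a))
    simp only [h]
    linarith
  let d : (Fin m → F) → F := fun x => infWith A 1 (h x)
  have hglb : ∀ x, IsGLB {t | t = 1 ∨ ∃ a ∈ A, t = h x a} (d x) := fun x =>
    isGLB_infWith hc hA (hhd.comp (s := fun a => (x, a)) (by fun_prop)) (l := 0) fun a _ =>
      (sumDist_nonneg x a).trans (hdist x a)
  have hdd : DefFun L F d := DefFun.infWith hA 1 hhd
  have hd0 : ∀ x, 0 ≤ d x := fun x => le_infWith (hglb x) zero_le_one fun a _ =>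
    (sumDist_nonneg x a).trans (hdist x a)
  have hdA : ∀ a ∈ A, d a = 0 := fun a ha => by
    refine le_antisymm ((infWith_le (hglb a) ha).trans ?_) (hd0 a)
    simp [h, hGA a ha]
  have hdpos : ∀ x ∈ X, x ∉ A → 0 < d x := fun x hx hxA => by
    refine (distTo_pos hc hA fun h => hxA (hcl x hx h)).trans_le (le_infWith (hglb x) ?_ ?_)
    · exact infWith_le_base (isGLB_distTo hc hA x)
    · exact fun a ha => (distTo_le hc hA x ha).trans (hdist x a)
  have hdc : ContinuousOn d X := by
    rw [continuousOn_iff_sumDist_abs]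
    intro x hx ε hε
    -- This bounds `|h y a - h x a|` uniformly in `a` and tends to `0` as `y → x` in `X`.
    have hM : ContinuousOn (fun y => sumDist y x + |ρ y - ρ x| + sumDist (G y) (G x)) X :=
      ((continuousOn_id.sumDist continuousOn_const).add
        (hρ.continuousOn.sub continuousOn_const).abs).add (hGc.sumDist continuousOn_const)
    obtain ⟨δ, hδ, hM⟩ := continuousOn_iff_sumDist_abs.mp hM x hx ε hε
    refine ⟨δ, hδ, fun y hy hyx => ?_⟩
    have h₁ := (abs_lt.mp (hM y hy hyx)).2
    simp only [sumDist_self, sub_self, abs_zero, add_zero, sub_zero] at h₁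
    refine (abs_infWith_sub_le (hglb y) (hglb x) ?_ fun a _ => ?_).trans_lt h₁
    · have := sumDist_nonneg y x
      have := sumDist_nonneg (G y) (G x)
      positivity
    · have h₂ := abs_le.mp (abs_sumDist_sub_le y x a)
      have h₃ := abs_le.mp (abs_sumDist_sub_le (G y) (G x) (sq (f a)))
      have h₄ := abs_le.mp (abs_abs_sub_abs_le_abs_sub (ρ y - ρ a) (ρ x - ρ a))
      rw [sub_sub_sub_cancel_right] at h₄
      simp only [h]
      rw [abs_le]
      constructor <;> linarith
  have hclose : ∀ x y, sumDist (join (G x) (d x) (d x • x)) (join (sq y) 0 0) =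
      sumDist (G x) (sq y) + (d x + sumDist (d x • x) 0) := fun x y => by
    rw [sumDist_join, sub_zero, abs_of_nonneg (hd0 x)]
  -- Scaling `x` by `d x` collapses this block on `A`, where only `f` may be remembered, but loses
  -- nothing off `A`.
  refine ⟨fun x => join (G x) (d x) (d x • x), fun y => join (sq y) 0 0,
    fun z i => unsquash (joinFst z i), joinMid, ?_⟩
  refine
    { defFun_left := defFun_join hGd hdd (DefFun.pi fun i => ?_)
      defFun_right := defFun_join hsqd (.const 0) (.const 0)
      defFun_inv := DefFun.pi fun i => ?_
      defFun_eqn := defFun_joinMid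
      continuousOn_left := continuousOn_join hGc hdc (hdc.smul continuousOn_id)
      continuous_right := ?_
      continuousAt_inv := fun y => continuousAt_pi.mpr fun i => ?_
      continuous_eqn := continuous_joinMid
      inv_right := fun y => ?_
      eqn_right := fun y => by simp
      eqn_left := fun x hx hxA => by simpa using (hdpos x hx hxA).ne'
      left_of_mem := fun a ha => by simp [hGA a ha, hdA a ha]
      left_inj := fun x hx hxA x' hx' hxA' heq => ?_
      proper_right := fun y hy => ?_
      proper_left := fun x₀ hx₀ hxA => ?_ }
  · simp only [Pi.smul_apply, smul_eq_mul]
    fun_prop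
  · exact defFun_unsquash.comp ((DefFun.apply i).comp defFun_joinFst)
  · rw [← continuousOn_univ]
    exact continuousOn_join hsqc.continuousOn continuousOn_const continuousOn_const
  · refine ContinuousAt.comp (g := unsquash)
      (f := fun z : Fin (n + (m + 1)) → F => joinFst z i) ?_ ?_
    · simpa [sq] using continuousAt_unsquash (y i)
    · exact ((continuous_apply i).comp continuous_joinFst).continuousAt
  · ext i
    simp [sq, unsquash_squash]
  · have h₁ := congrArg joinMid heq
    have h₂ := congrArg joinLast heq
    simp only [joinMid_join, joinLast_join] at h₁ h₂
    rw [h₁] at h₂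
    exact smul_right_injective _ (hdpos x' hx' hxA').ne' h₂
  · obtain ⟨ε₀, hε₀, r, hr⟩ := hρ.locally_bounded hc hA hAX hcl hf hfc hfY hprop hy
    have huc : ContinuousAt (fun (z : Fin n → F) i => unsquash (z i)) (sq y) :=
      continuousAt_pi.mpr fun i => ContinuousAt.comp (g := unsquash)
        (f := fun z : Fin n → F => z i) (continuousAt_unsquash (y i)) (continuousAt_apply i _)
    obtain ⟨ε₁, hε₁, hu⟩ := ((nhds_basis_sumDist _).tendsto_iff (nhds_basis_sumDist _)).mp huc
      ε₀ hε₀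
    -- One half of `ε₁` goes to `G x` against `sq y`, the other to `G x` against `sq (f a)`. The
    -- bound `1` gives `|ρ x - ρ a| < 1`, hence `r + 1`.
    refine ⟨min (ε₁ / 2) 1, lt_min (by positivity) one_pos, r + 1, fun x hx hlt => ?_⟩
    rw [hclose] at hlt
    have h₁ := sumDist_nonneg (d x • x) 0
    have h₂ := sumDist_nonneg (G x) (sq y)
    obtain ⟨a, ha, hlt'⟩ := exists_lt_of_infWith_lt (hglb x)
      (show d x < min (ε₁ / 2) 1 by linarith) (min_le_right _ _)
    have h₃ := hlt.trans_le (min_le_left _ _)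
    have h₄ := hlt'.trans_le (min_le_left _ _)
    have h₅ := hlt'.trans_le (min_le_right _ _)
    have h₆ := sumDist_nonneg x a
    have h₇ := sumDist_nonneg (G x) (sq (f a))
    have h₈ := abs_nonneg (ρ x - ρ a)
    have h₉ := sumDist_triangle (sq (f a)) (G x) (sq y)
    rw [sumDist_comm (sq (f a)) (G x)] at h₉
    simp only [h] at h₄ h₅
    have hfa := hu (sq (f a)) (by change _ < _; linarith [hd0 x])
    simp only [sq, unsquash_squash, mem_ofPred_eq] at hfa
    linarith [hr a ha hfa, le_abs_self (ρ x - ρ a)]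
  · obtain ⟨δ, hδ, hρδ⟩ := continuousOn_iff_sumDist_abs.mp hρ.continuousOn x₀ hx₀ 1 one_pos
    have hpos := hdpos x₀ hx₀ hxA
    have hφ : ContinuousAt (fun z : Fin (n + (m + 1)) → F => (joinMid z)⁻¹ • joinLast z)
        (join (G x₀) (d x₀) (d x₀ • x₀)) :=
      (continuous_joinMid.continuousAt.inv₀ (by simpa using hpos.ne')).smul
        continuous_joinLast.continuousAt
    have hφ₀ : (joinMid (join (G x₀) (d x₀) (d x₀ • x₀)))⁻¹ •
        joinLast (join (G x₀) (d x₀) (d x₀ • x₀)) = x₀ := by simp [smul_smul, hpos.ne']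
    have hev := (hφ.eventually_mem (by rw [hφ₀]; exact (nhds_basis_sumDist x₀).mem_of_mem hδ)).and
      (continuous_joinMid.continuousAt.eventually_ne
        (show joinMid (join (G x₀) (d x₀) (d x₀ • x₀)) ≠ 0 by simpa using hpos.ne'))
    obtain ⟨ε, hε, hball⟩ := (nhds_basis_sumDist _).eventually_iff.mp hev
    refine ⟨ε, hε, ρ x₀ + 1, fun x hx hlt => ?_⟩
    obtain ⟨h₁, h₂⟩ := hball hlt
    simp only [joinMid_join, joinLast_join, mem_ofPred_eq] at h₁ h₂
    rw [smul_smul, inv_mul_cancel₀ h₂, one_smul] at h₁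
    linarith [(abs_lt.mp (hρδ x hx h₁)).2]

end Gluing

/-! ### Fibres, properness and the identifying property of a gluing -/

section Gluing

variable {L : FirstOrder.Language.{u, v}} {F : Type w} [Field F] [LinearOrder F]
  [IsStrictOrderedRing F] [L.Structure F] [hF : Fact (ExpandsOrderedField L F)]
  [TopologicalSpace F] [OrderTopology F] {m n N : ℕ} {X A : Set (Fin m → F)}
  {Y : Set (Fin n → F)} {f : (Fin m → F) → (Fin n → F)} {ρ : (Fin m → F) → F}
  {P : (Fin m → F) → (Fin N → F)} {Q : (Fin n → F) → (Fin N → F)}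
  {Γ : (Fin N → F) → (Fin n → F)} {e : (Fin N → F) → F}

namespace IsGluing

theorem eq_left_iff (hP : IsGluing L X A Y f ρ P Q Γ e) {x x' : Fin m → F} (hx : x ∈ X)
    (hx' : x' ∈ X) : P x = P x' ↔ x = x' ∨ (x ∈ A ∧ x' ∈ A ∧ f x = f x') := by
  constructor
  · intro h
    by_cases hxA : x ∈ A
    · by_cases hxA' : x' ∈ A
      · refine Or.inr ⟨hxA, hxA', ?_⟩
        rw [hP.left_of_mem x hxA, hP.left_of_mem x' hxA'] at h
        rw [← hP.inv_right (f x), h, hP.inv_right]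
      · refine absurd ?_ (hP.eqn_left x' hx' hxA')
        rw [← h, hP.left_of_mem x hxA, hP.eqn_right]
    · by_cases hxA' : x' ∈ A
      · refine absurd ?_ (hP.eqn_left x hx hxA)
        rw [h, hP.left_of_mem x' hxA', hP.eqn_right]
      · exact Or.inl (hP.left_inj x hx hxA x' hx' hxA' h)
  · rintro (rfl | ⟨hxA, hxA', h⟩)
    · rfl
    · rw [hP.left_of_mem x hxA, hP.left_of_mem x' hxA', h]

theorem eq_right_iff (hP : IsGluing L X A Y f ρ P Q Γ e) {x : Fin m → F} {y : Fin n → F}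
    (hx : x ∈ X) : P x = Q y ↔ x ∈ A ∧ f x = y := by
  constructor
  · intro h
    have hxA : x ∈ A := by
      by_contra hxA
      exact hP.eqn_left x hx hxA (by rw [h, hP.eqn_right])
    rw [hP.left_of_mem x hxA] at h
    exact ⟨hxA, by rw [← hP.inv_right (f x), h, hP.inv_right]⟩
  · rintro ⟨hxA, rfl⟩
    exact hP.left_of_mem x hxA

theorem right_injective (hP : IsGluing L X A Y f ρ P Q Γ e) : Function.Injective Q :=
  Function.LeftInverse.injective hP.inv_right

theorem mem_image_right (hP : IsGluing L X A Y f ρ P Q Γ e) (hfY : MapsTo f A Y)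
    {z : Fin N → F} (hz : z ∈ P '' X ∪ Q '' Y) (hez : e z = 0) : z ∈ Q '' Y := by
  rcases hz with ⟨x, hx, rfl⟩ | hz
  · have hxA : x ∈ A := by
      by_contra hxA
      exact hP.eqn_left x hx hxA hez
    exact ⟨f x, hfY hxA, (hP.left_of_mem x hxA).symm⟩
  · exact hz

theorem locally_bounded (hP : IsGluing L X A Y f ρ P Q Γ e) (hfY : MapsTo f A Y)
    {z : Fin N → F} (hz : z ∈ P '' X ∪ Q '' Y) :
    ∃ ε > 0, ∃ r, ∀ x ∈ X, sumDist (P x) z < ε → ρ x ≤ r := by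
  rcases hz with ⟨x, hx, rfl⟩ | ⟨y, hy, rfl⟩
  · by_cases hxA : x ∈ A
    · rw [hP.left_of_mem x hxA]
      exact hP.proper_right _ (hfY hxA)
    · exact hP.proper_left x hx hxA
  · exact hP.proper_right y hy

variable {K : Set (Fin N → F)}

/-- If `ρ` were unbounded on the inverse image, the values of `P` would cluster at some `z ∈ K`,
against the local bound at `z`. The inverse image thus lies in a closed bounded sublevel set of `ρ`,
on which `P` is continuous. -/
theorem proper_preimage_left (hP : IsGluing L X A Y f ρ P Q Γ e) (hc : DefinablyComplete L F)
    (hρ : IsExhaustion L X ρ) (hfY : MapsTo f A Y) (hK : Def L F (· ∈ K))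
    (hKZ : K ⊆ P '' X ∪ Q '' Y) (hKc : IsClosed K) (hKb : IsBdd K) :
    IsClosed {x | x ∈ X ∧ P x ∈ K} ∧ IsBdd {x | x ∈ X ∧ P x ∈ K} := by
  obtain ⟨r, hr⟩ : ∃ r, ∀ x ∈ X, P x ∈ K → ρ x ≤ r := by
    by_contra! hcon
    have hPd := hP.defFun_left
    have hρd := hρ.defFun
    obtain ⟨z, hzK, hcl⟩ := exists_cluster hc hKc hKb
      (S := fun s z => z ∈ K ∧ ∃ x, x ∈ X ∧ (P x = z ∧ s ≤ ρ x))
      (Def.and (hK.comp (by fun_prop)) (Def.exists (Def.and (hρ.def_mem.comp (by fun_prop))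
        (by fun_prop)))) (fun s z h => h.1) fun r => by
        obtain ⟨x, hx, hxK, hrx⟩ := hcon r
        exact ⟨r, le_rfl, P x, hxK, x, hx, rfl, hrx.le⟩
    obtain ⟨ε, hε, r, hr⟩ := hP.locally_bounded hfY (hKZ hzK)
    obtain ⟨s, hs, _, hxU, -, x, hx, rfl, hsx⟩ := hcl _
      (mem_nhdsWithin_of_mem_nhds ((nhds_basis_sumDist z).mem_of_mem hε)) (r + 1)
    linarith [hr x hx hxU]
  have heq : {x | x ∈ X ∧ P x ∈ K} = {x | x ∈ X ∧ ρ x ≤ r} ∩ P ⁻¹' K := by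
    ext x
    exact ⟨fun h => ⟨⟨h.1, hr x h.1 h.2⟩, h.2⟩, fun h => ⟨h.1.1, h.2⟩⟩
  refine ⟨?_, (hρ.isBdd r).mono fun x hx => ⟨hx.1, hr x hx.1 hx.2⟩⟩
  rw [heq]
  exact (hP.continuousOn_left.mono fun x hx => hx.1).preimage_isClosed_of_isClosed
    (hρ.isClosed r) hKc

/-- The inverse image is `Γ (K ∩ {e = 0})`, a continuous image of a closed bounded set; no local
closedness of `Y` is needed. -/
theorem proper_preimage_right (hP : IsGluing L X A Y f ρ P Q Γ e) (hc : DefinablyComplete L F)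
    (hfY : MapsTo f A Y) (hK : Def L F (· ∈ K))
    (hKZ : K ⊆ P '' X ∪ Q '' Y) (hKc : IsClosed K) (hKb : IsBdd K) :
    IsClosed {y | y ∈ Y ∧ Q y ∈ K} ∧ IsBdd {y | y ∈ Y ∧ Q y ∈ K} := by
  have heq : {y | y ∈ Y ∧ Q y ∈ K} = Γ '' {z | z ∈ K ∧ e z = 0} := by
    ext y
    constructor
    · rintro ⟨-, hyK⟩
      exact ⟨Q y, ⟨hyK, hP.eqn_right y⟩, hP.inv_right y⟩
    · rintro ⟨z, ⟨hzK, hz⟩, rfl⟩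
      obtain ⟨y, hy, rfl⟩ := hP.mem_image_right hfY (hKZ hzK) hz
      rw [mem_ofPred_eq, hP.inv_right]
      exact ⟨hy, hzK⟩
  have hcl : IsClosed {z | z ∈ K ∧ e z = 0} :=
    hKc.inter (isClosed_singleton.preimage hP.continuous_eqn)
  have hbd : IsBdd {z | z ∈ K ∧ e z = 0} := hKb.mono fun z hz => hz.1
  have hd : Def L F (· ∈ {z | z ∈ K ∧ e z = 0}) := hK.and (Def.eq hP.defFun_eqn (.const 0))
  have hcont : ContinuousOn Γ {z | z ∈ K ∧ e z = 0} := by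
    rintro z ⟨hzK, hz⟩
    obtain ⟨y, -, rfl⟩ := hP.mem_image_right hfY (hKZ hzK) hz
    exact (hP.continuousAt_inv y).continuousWithinAt
  rw [heq]
  exact ⟨isClosed_image_of_isBdd hc hcl hbd hd hP.defFun_inv hcont,
    isBdd_image_of_isClosed hc hcl hbd hd hP.defFun_inv hcont⟩

/-- A limit of points of `P '' X` in the image is already a limit of points with bounded `ρ`, which
form a closed image. A limit of points of `Q '' Y` satisfies `e = 0`, and the continuous inverse `Γ`
carries the question back to `Y`. -/
theorem mem_of_mem_closure (hP : IsGluing L X A Y f ρ P Q Γ e) (hc : DefinablyComplete L F)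
    (hρ : IsExhaustion L X ρ) (hfY : MapsTo f A Y) (hK : Def L F (· ∈ K))
    (hKZ : K ⊆ P '' X ∪ Q '' Y)
    (hKX : ∀ x ∈ X, x ∈ closure {x | x ∈ X ∧ P x ∈ K} → P x ∈ K)
    (hKY : ∀ y ∈ Y, y ∈ closure {y | y ∈ Y ∧ Q y ∈ K} → Q y ∈ K)
    {z : Fin N → F} (hz : z ∈ P '' X ∪ Q '' Y) (hzK : z ∈ closure K) : z ∈ K := by
  have hsub : K ⊆ P '' {x | x ∈ X ∧ P x ∈ K} ∪ Q '' {y | y ∈ Y ∧ Q y ∈ K} := by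
    intro w hw
    rcases hKZ hw with ⟨x, hx, rfl⟩ | ⟨y, hy, rfl⟩
    · exact Or.inl ⟨x, ⟨hx, hw⟩, rfl⟩
    · exact Or.inr ⟨y, ⟨hy, hw⟩, rfl⟩
  have hzK' := closure_mono hsub hzK
  rw [closure_union] at hzK'
  rcases hzK' with hzP | hzQ
  · obtain ⟨ε, hε, r, hr⟩ := hP.locally_bounded hfY hz
    let B : Set (Fin m → F) := {x | x ∈ X ∧ P x ∈ K}
    have hBX : B ⊆ X := fun x hx => hx.1
    have hρd := hρ.defFun
    have hcl : IsClosed (P '' {x | x ∈ B ∧ ρ x ≤ r}) :=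
      isClosed_image_of_isBdd hc (hρ.isClosed_inter hBX (fun x hx hxB => ⟨hx, hKX x hx hxB⟩) r)
        (hρ.isBdd_inter hBX r) ((hρ.def_mem.and (hK.comp hP.defFun_left)).and (by fun_prop))
        hP.defFun_left (hP.continuousOn_left.mono fun x hx => hx.1.1)
    have hmem : z ∈ P '' {x | x ∈ B ∧ ρ x ≤ r} := by
      rw [← hcl.closure_eq, mem_closure_iff_sumDist]
      intro δ hδ
      obtain ⟨_, ⟨x, hx, rfl⟩, hlt⟩ := mem_closure_iff_sumDist.mp hzP (min δ ε) (lt_min hδ hε)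
      exact ⟨P x, ⟨x, ⟨hx, hr x hx.1 (hlt.trans_le (min_le_right _ _))⟩, rfl⟩,
        hlt.trans_le (min_le_left _ _)⟩
    obtain ⟨x, ⟨⟨-, hxK⟩, -⟩, rfl⟩ := hmem
    exact hxK
  · have hez : e z = 0 := by
      have hcl : IsClosed {z | e z = 0} := isClosed_singleton.preimage hP.continuous_eqn
      refine closure_minimal (t := {z | e z = 0}) ?_ hcl hzQ
      rintro _ ⟨y, -, rfl⟩
      exact hP.eqn_right y
    obtain ⟨y, hy, rfl⟩ := hP.mem_image_right hfY hz hez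
    refine hKY y hy ?_
    have h := mem_closure_image (hP.continuousAt_inv y) hzQ
    rw [hP.inv_right] at h
    refine closure_mono ?_ h
    rintro _ ⟨_, ⟨y', hy', rfl⟩, rfl⟩
    rw [hP.inv_right]
    exact hy'

end IsGluing

end Gluing

/-! ### Passage between maps of subtypes and total maps; disjoint sums -/

section Subtypes

variable {L : FirstOrder.Language.{u, v}} {F : Type w} [Field F] [LinearOrder F]
  [IsStrictOrderedRing F] [L.Structure F] {m n : ℕ} {X : Set (Fin m → F)} {Y : Set (Fin n → F)}

theorem isClosed_subtype_iff {α : Type*} [TopologicalSpace α] {X B : Set α} :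
    IsClosed {x : X | (x : α) ∈ B} ↔ ∀ x ∈ X, x ∈ closure {x | x ∈ X ∧ x ∈ B} → x ∈ B := by
  have himg : Subtype.val '' {x : X | (x : α) ∈ B} = {x | x ∈ X ∧ x ∈ B} :=
    Subtype.image_preimage_coe X B
  rw [← closure_subset_iff_isClosed]
  constructor
  · intro h x hx hxB
    exact @h ⟨x, hx⟩ (closure_subtype.mpr (by rwa [himg]))
  · intro h x hx
    exact h x x.2 (by rw [← himg]; exact closure_subtype.mp hx)

theorem def_prod_iff {P : (Fin m → F) × (Fin n → F) → Prop} : Def L F P ↔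
    IsDefinable L {v : Fin m ⊕ Fin n → F | P (v ∘ Sum.inl, v ∘ Sum.inr)} := Iff.rfl

theorem eq_sumElim_iff {ι κ : Type*} {v : ι ⊕ κ → F} {x : ι → F} {y : κ → F} :
    v = Sum.elim x y ↔ v ∘ Sum.inl = x ∧ v ∘ Sum.inr = y := by
  constructor
  · rintro rfl
    exact ⟨rfl, rfl⟩
  · rintro ⟨rfl, rfl⟩
    exact (Sum.elim_comp_inl_inr v).symm

theorem isDefinable_graph_iff {g : X → Y} : IsDefinable L (graph g) ↔
    Def L F fun p : (Fin m → F) × (Fin n → F) => ∃ x : X, p.1 = x ∧ p.2 = g x := by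
  rw [def_prod_iff]
  refine iff_of_eq (congrArg (IsDefinable L) ?_)
  ext v
  simp only [graph, mem_ofPred_eq, eq_sumElim_iff]

/-- The extension of a map by `0` outside its domain. -/
noncomputable def extendZero (g : X → Y) (x : Fin m → F) : Fin n → F :=
  open Classical in if hx : x ∈ X then g ⟨x, hx⟩ else 0

@[simp]
theorem extendZero_coe (g : X → Y) (x : X) : extendZero g x = g x := by
  simp [extendZero]

theorem extendZero_of_mem (g : X → Y) {x : Fin m → F} (hx : x ∈ X) :
    extendZero g x = g ⟨x, hx⟩ := extendZero_coe g ⟨x, hx⟩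

theorem IsDefinableMap.defFun {g : X → Y} (hg : IsDefinableMap L g) :
    DefFun L F (extendZero g) := by
  have hX : Def L F (· ∈ X) := hg.dom
  have : Def L F fun p : (Fin m → F) × (Fin n → F) =>
      (∃ x : X, p.1 = x ∧ p.2 = g x) ∨ (p.1 ∉ X ∧ p.2 = 0) :=
    (isDefinable_graph_iff.mp hg.graph).or ((hX.comp (by fun_prop)).not.and (by fun_prop))
  refine (congrArg (Def L F) ?_).mp this
  ext ⟨x, y⟩
  by_cases hx : x ∈ X
  · simp [extendZero, hx, eq_comm]
  · simp [extendZero, hx, eq_comm]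

theorem continuousOn_extendZero [TopologicalSpace F] {g : X → Y} (hg : Continuous g) :
    ContinuousOn (extendZero g) X := by
  rw [continuousOn_iff_continuous_domRestrict]
  have : X.domRestrict (extendZero g) = Subtype.val ∘ g := funext fun x => extendZero_coe g x
  rw [this]
  exact continuous_subtype_val.comp hg

theorem exists_disjointSum [Fact (ExpandsOrderedField L F)] [TopologicalSpace F]
    [OrderTopology F] (hX : IsDefinable L X) (hY : IsDefinable L Y) :
    ∃ (k : ℕ) (T : Set (Fin k → F)) (h₁ : X → T) (h₂ : Y → T), IsDisjointSum L h₁ h₂ := by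
  have hX' : Def L F (· ∈ X) := hX
  have hY' : Def L F (· ∈ Y) := hY
  -- The middle coordinate is `0` on the copy of `X` and `1` on that of `Y`, which makes both copies
  -- open in their union.
  let i₁ : (Fin m → F) → (Fin (m + (n + 1)) → F) := fun x => join x 0 0
  let i₂ : (Fin n → F) → (Fin (m + (n + 1)) → F) := fun y => join 0 1 y
  have hi₁ : DefFun L F i₁ := defFun_join .id (.const 0) (.const 0)
  have hi₂ : DefFun L F i₂ := defFun_join (.const 0) (.const 1) .id
  have hc₁ : Continuous i₁ := by
    rw [← continuousOn_univ]
    exact continuousOn_join continuousOn_id continuousOn_const continuousOn_const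
  have hc₂ : Continuous i₂ := by
    rw [← continuousOn_univ]
    exact continuousOn_join continuousOn_const continuousOn_const continuousOn_id
  let T : Set (Fin (m + (n + 1)) → F) := i₁ '' X ∪ i₂ '' Y
  have hT : IsDefinable L T := by
    have : Def L F fun z : Fin (m + (n + 1)) → F =>
        (∃ x, x ∈ X ∧ i₁ x = z) ∨ ∃ y, y ∈ Y ∧ i₂ y = z :=
      (Def.exists ((hX'.comp (by fun_prop)).and (by fun_prop))).or
        (Def.exists ((hY'.comp (by fun_prop)).and (by fun_prop)))
    exact this
  let h₁ : X → T := fun x => ⟨i₁ x, Or.inl ⟨x, x.2, rfl⟩⟩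
  let h₂ : Y → T := fun y => ⟨i₂ y, Or.inr ⟨y, y.2, rfl⟩⟩
  have hr₁ : range h₁ = {t : T | joinMid (t : Fin (m + (n + 1)) → F) ≠ 1} := by
    ext ⟨t, ht⟩
    constructor
    · rintro ⟨x, hx⟩
      simp [← hx, h₁, i₁]
    · intro h
      rcases ht with ⟨x, hx, rfl⟩ | ⟨y, hy, rfl⟩
      · exact ⟨⟨x, hx⟩, rfl⟩
      · simp [i₂] at h
  have hr₂ : range h₂ = {t : T | joinMid (t : Fin (m + (n + 1)) → F) ≠ 0} := by
    ext ⟨t, ht⟩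
    constructor
    · rintro ⟨y, hy⟩
      simp [← hy, h₂, i₂]
    · intro h
      rcases ht with ⟨x, hx, rfl⟩ | ⟨y, hy, rfl⟩
      · simp [i₁] at h
      · exact ⟨⟨y, hy⟩, rfl⟩
  have hmid : Continuous fun t : T => joinMid (t : Fin (m + (n + 1)) → F) :=
    continuous_joinMid.comp continuous_subtype_val
  refine ⟨m + (n + 1), T, h₁, h₂,
    { definable_left := ⟨hX, hT, isDefinable_graph_iff.mpr ?_⟩
      definable_right := ⟨hY, hT, isDefinable_graph_iff.mpr ?_⟩
      embedding_left := ?_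
      embedding_right := ?_
      isOpen_left := by rw [hr₁]; exact isOpen_ne.preimage hmid
      isOpen_right := by rw [hr₂]; exact isOpen_ne.preimage hmid
      disjoint := ?_
      union := ?_ }⟩
  · have : Def L F fun p : (Fin m → F) × (Fin (m + (n + 1)) → F) => p.1 ∈ X ∧ p.2 = i₁ p.1 :=
      (hX'.comp (by fun_prop)).and (by fun_prop)
    simpa [h₁] using this
  · have : Def L F fun p : (Fin n → F) × (Fin (m + (n + 1)) → F) => p.1 ∈ Y ∧ p.2 = i₂ p.1 :=
      (hY'.comp (by fun_prop)).and (by fun_prop)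
    simpa [h₂] using this
  · refine Topology.IsEmbedding.of_comp (g := Subtype.val)
      (Continuous.subtype_mk (hc₁.comp continuous_subtype_val) _) continuous_subtype_val ?_
    exact (Function.LeftInverse.isEmbedding (f := joinFst) (fun x => by simp [i₁])
      continuous_joinFst hc₁).comp Topology.IsEmbedding.subtypeVal
  · refine Topology.IsEmbedding.of_comp (g := Subtype.val)
      (Continuous.subtype_mk (hc₂.comp continuous_subtype_val) _) continuous_subtype_val ?_
    exact (Function.LeftInverse.isEmbedding (f := joinLast) (fun x => by simp [i₂])
      continuous_joinLast hc₂).comp Topology.IsEmbedding.subtypeVal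
  · rw [Set.disjoint_left]
    rintro _ ⟨x, rfl⟩ ⟨y, hy⟩
    have := congrArg (fun t : T => joinMid (t : Fin (m + (n + 1)) → F)) hy
    simp [h₁, h₂, i₁, i₂] at this
  · ext ⟨t, ht⟩
    simp only [mem_union, mem_univ, iff_true]
    rcases ht with ⟨x, hx, rfl⟩ | ⟨y, hy, rfl⟩
    · exact Or.inl ⟨⟨x, hx⟩, rfl⟩
    · exact Or.inr ⟨⟨y, hy⟩, rfl⟩

end Subtypes

/-! ### The quotient map on an arbitrary disjoint sum -/

section Quotient

variable {L : FirstOrder.Language.{u, v}} {F : Type w} [Field F] [LinearOrder F]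
  [IsStrictOrderedRing F] [L.Structure F] [hF : Fact (ExpandsOrderedField L F)]
  [TopologicalSpace F] [OrderTopology F] {m n N k : ℕ} {X A : Set (Fin m → F)}
  {Y : Set (Fin n → F)} {T : Set (Fin k → F)} {h₁ : X → T} {h₂ : Y → T}

theorem IsDisjointSum.cases (hT : IsDisjointSum L h₁ h₂) (t : T) :
    (∃ x, h₁ x = t) ∨ ∃ y, h₂ y = t := by
  have : t ∈ range h₁ ∪ range h₂ := by rw [hT.union]; trivial
  exact this

theorem IsDisjointSum.ne (hT : IsDisjointSum L h₁ h₂) (x : X) (y : Y) : h₁ x ≠ h₂ y := fun h =>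
  Set.disjoint_left.mp hT.disjoint ⟨x, rfl⟩ ⟨y, h.symm⟩

theorem isDefinable_graph_of_cases {Z : Set (Fin N → F)} (hT : IsDisjointSum L h₁ h₂)
    {P : (Fin m → F) → (Fin N → F)} {Q : (Fin n → F) → (Fin N → F)} (hP : DefFun L F P)
    (hQ : DefFun L F Q) {p : T → Z} (hp₁ : ∀ x, (p (h₁ x) : Fin N → F) = P x)
    (hp₂ : ∀ y, (p (h₂ y) : Fin N → F) = Q y) : IsDefinable L (graph p) := by
  have hX : Def L F (· ∈ X) := hT.definable_left.dom
  have hY : Def L F (· ∈ Y) := hT.definable_right.dom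
  have hd₁ := hT.definable_left.defFun
  have hd₂ := hT.definable_right.defFun
  rw [isDefinable_graph_iff]
  have : Def L F fun q : (Fin k → F) × (Fin N → F) =>
      (∃ x, x ∈ X ∧ (q.1 = extendZero h₁ x ∧ q.2 = P x)) ∨
        ∃ y, y ∈ Y ∧ (q.1 = extendZero h₂ y ∧ q.2 = Q y) :=
    (Def.exists ((hX.comp (by fun_prop)).and (by fun_prop))).or
      (Def.exists ((hY.comp (by fun_prop)).and (by fun_prop)))
  refine (congrArg (Def L F) ?_).mp this
  ext ⟨t, z⟩
  constructor
  · rintro (⟨x, hx, ht, hz⟩ | ⟨y, hy, ht, hz⟩)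
    · exact ⟨h₁ ⟨x, hx⟩, by rw [ht, extendZero_of_mem h₁ hx], by rw [hz, hp₁]⟩
    · exact ⟨h₂ ⟨y, hy⟩, by rw [ht, extendZero_of_mem h₂ hy], by rw [hz, hp₂]⟩
  · rintro ⟨t, ht, hz⟩
    rcases hT.cases t with ⟨x, rfl⟩ | ⟨y, rfl⟩
    · exact Or.inl ⟨x, x.2, by rw [ht, extendZero_coe], by rw [hz, hp₁]⟩
    · exact Or.inr ⟨y, y.2, by rw [ht, extendZero_coe], by rw [hz, hp₂]⟩

theorem continuous_of_cases {Z : Type*} [TopologicalSpace Z] (hT : IsDisjointSum L h₁ h₂)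
    {p : T → Z} (hp₁ : Continuous (p ∘ h₁)) (hp₂ : Continuous (p ∘ h₂)) : Continuous p := by
  have ho₁ : Topology.IsOpenEmbedding h₁ := ⟨hT.embedding_left, hT.isOpen_left⟩
  have ho₂ : Topology.IsOpenEmbedding h₂ := ⟨hT.embedding_right, hT.isOpen_right⟩
  rw [continuous_iff_continuousAt]
  intro t
  rcases hT.cases t with ⟨x, rfl⟩ | ⟨y, rfl⟩
  · exact ho₁.continuousAt_iff.mp hp₁.continuousAt
  · exact ho₂.continuousAt_iff.mp hp₂.continuousAt

/-- The kernel of a definable map is a definable equivalence relation. -/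
theorem isDefinableEquivalence_of_eq_iff {Z : Set (Fin N → F)} {p : T → Z}
    (hp : IsDefinableMap L p) {E : Set (T × T)} (hE : ∀ t t', p t = p t' ↔ (t, t') ∈ E) :
    IsDefinableEquivalence L T E := by
  have hg := isDefinable_graph_iff.mp hp.graph
  refine ⟨hp.dom, ?_, ?_⟩
  · have : Def L F fun q : (Fin k → F) × (Fin k → F) =>
        ∃ z : Fin N → F, (∃ t : T, q.1 = t ∧ z = p t) ∧ ∃ t : T, q.2 = t ∧ z = p t :=
      Def.exists (Def.and
        (hg.comp (t := fun q : ((Fin k → F) × (Fin k → F)) × (Fin N → F) => (q.1.1, q.2))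
          (by fun_prop))
        (hg.comp (t := fun q : ((Fin k → F) × (Fin k → F)) × (Fin N → F) => (q.1.2, q.2))
          (by fun_prop)))
    rw [def_prod_iff] at this
    refine (congrArg (IsDefinable L) ?_).mp this
    ext v
    simp only [mem_ofPred_eq, eq_sumElim_iff]
    constructor
    · rintro ⟨z, ⟨t, ht, hz⟩, t', ht', hz'⟩
      exact ⟨(t, t'), (hE t t').mp (Subtype.ext (hz.symm.trans hz')), ht, ht'⟩
    · rintro ⟨⟨t, t'⟩, he, ht, ht'⟩
      exact ⟨p t, ⟨t, ht, rfl⟩, t', ht', by rw [(hE t t').mpr he]⟩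
  · simp only [← hE]
    exact ⟨fun _ => rfl, fun h => h.symm, fun h h' => h.trans h'⟩

/-- Injectivity and disjoint ranges of `h₁` and `h₂` leave, for each choice of sides, only the
matching pieces of the five-fold union. -/
theorem mem_attachingRel_iff {hAX : A ⊆ X} {f : A → Y} (hT : IsDisjointSum L h₁ h₂) :
    (∀ x x', (h₁ x, h₁ x') ∈ attachingRel h₁ h₂ hAX f ↔ x = x' ∨
      ∃ (hx : (x : Fin m → F) ∈ A) (hx' : (x' : Fin m → F) ∈ A), f ⟨x, hx⟩ = f ⟨x', hx'⟩) ∧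
    (∀ x y, (h₁ x, h₂ y) ∈ attachingRel h₁ h₂ hAX f ↔
      ∃ hx : (x : Fin m → F) ∈ A, f ⟨x, hx⟩ = y) ∧
    (∀ y x, (h₂ y, h₁ x) ∈ attachingRel h₁ h₂ hAX f ↔
      ∃ hx : (x : Fin m → F) ∈ A, f ⟨x, hx⟩ = y) ∧
    ∀ y y', (h₂ y, h₂ y') ∈ attachingRel h₁ h₂ hAX f ↔ y = y' := by
  have hi₁ : ∀ x x', h₁ x = h₁ x' ↔ x = x' := fun _ _ => hT.embedding_left.injective.eq_iff
  have hi₂ : ∀ y y', h₂ y = h₂ y' ↔ y = y' := fun _ _ => hT.embedding_right.injective.eq_iff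
  have hn := hT.ne
  have hn' := fun x y => (hT.ne x y).symm
  have hinc : ∀ (x : X) (a : A), x = inclusion hAX a ↔ (x : Fin m → F) = a := fun x a =>
    Subtype.ext_iff
  refine ⟨fun x x' => ?_, fun x y => ?_, fun y x => ?_, fun y y' => ?_⟩ <;>
    simp only [attachingRel, mem_union, mem_ofPred_eq, Prod.mk.injEq, hi₁, hi₂, hn, hn', hinc,
      and_false, false_and, exists_false, or_false, false_or]
  · constructor
    · rintro (⟨_, rfl, rfl⟩ | ⟨a₁, a₂, h, ha₁, ha₂⟩)
      · exact Or.inl rfl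
      · refine Or.inr ⟨ha₁ ▸ a₁.2, ha₂ ▸ a₂.2, ?_⟩
        simpa only [ha₁, ha₂] using h
    · rintro (rfl | ⟨hx, hx', h⟩)
      · exact Or.inl ⟨x, rfl, rfl⟩
      · exact Or.inr ⟨⟨x, hx⟩, ⟨x', hx'⟩, h, rfl, rfl⟩
  · constructor
    · rintro ⟨a, h, rfl⟩
      exact ⟨h ▸ a.2, by simp only [h]⟩
    · rintro ⟨hx, rfl⟩
      exact ⟨⟨x, hx⟩, rfl, rfl⟩
  · constructor
    · rintro ⟨a, rfl, h⟩
      exact ⟨h ▸ a.2, by simp only [h]⟩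
    · rintro ⟨hx, rfl⟩
      exact ⟨⟨x, hx⟩, rfl, rfl⟩
  · constructor
    · rintro ⟨_, rfl, rfl⟩
      rfl
    · rintro rfl
      exact ⟨y, rfl, rfl⟩

theorem IsGluing.exists_properQuotient (hc : DefinablyComplete L F) {ρ : (Fin m → F) → F}
    (hρ : IsExhaustion L X ρ) {hAX : A ⊆ X} {f : A → Y} {P : (Fin m → F) → (Fin N → F)}
    {Q : (Fin n → F) → (Fin N → F)} {Γ : (Fin N → F) → (Fin n → F)} {e : (Fin N → F) → F}
    (hP : IsGluing L X A Y (extendZero f) ρ P Q Γ e) (hT : IsDisjointSum L h₁ h₂) :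
    ∃ (Z : Set (Fin N → F)) (p : T → Z),
      IsDefinableProperQuotient L (attachingRel h₁ h₂ hAX f) p := by
  have hX : Def L F (· ∈ X) := hT.definable_left.dom
  have hY : Def L F (· ∈ Y) := hT.definable_right.dom
  have hPd := hP.defFun_left
  have hQd := hP.defFun_right
  have hfY : MapsTo (extendZero f) A Y := fun a ha => by
    rw [extendZero_of_mem f ha]
    exact (f _).2
  let Z : Set (Fin N → F) := P '' X ∪ Q '' Y
  have hex : ∀ t : T, ∃ z : Z, (∃ x, h₁ x = t ∧ (z : Fin N → F) = P x) ∨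
      ∃ y, h₂ y = t ∧ (z : Fin N → F) = Q y := fun t => by
    rcases hT.cases t with ⟨x, hx⟩ | ⟨y, hy⟩
    · exact ⟨⟨P x, Or.inl ⟨x, x.2, rfl⟩⟩, Or.inl ⟨x, hx, rfl⟩⟩
    · exact ⟨⟨Q y, Or.inr ⟨y, y.2, rfl⟩⟩, Or.inr ⟨y, hy, rfl⟩⟩
  choose p hp using hex
  have hp₁ : ∀ x, (p (h₁ x) : Fin N → F) = P x := fun x => by
    rcases hp (h₁ x) with ⟨x', hx', h⟩ | ⟨y, hy, h⟩
    · rw [h, hT.embedding_left.injective hx']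
    · exact absurd hy.symm (hT.ne x y)
  have hp₂ : ∀ y, (p (h₂ y) : Fin N → F) = Q y := fun y => by
    rcases hp (h₂ y) with ⟨x, hx, h⟩ | ⟨y', hy', h⟩
    · exact absurd hx (hT.ne x y)
    · rw [h, hT.embedding_right.injective hy']
  have hZ : IsDefinable L Z := by
    have : Def L F fun z : Fin N → F => (∃ x, x ∈ X ∧ P x = z) ∨ ∃ y, y ∈ Y ∧ Q y = z :=
      (Def.exists ((hX.comp (by fun_prop)).and (by fun_prop))).or
        (Def.exists ((hY.comp (by fun_prop)).and (by fun_prop)))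
    exact this
  have hmap : IsDefinableMap L p :=
    ⟨hT.definable_left.cod, hZ, isDefinable_graph_of_cases hT hPd hQd hp₁ hp₂⟩
  have hcont : Continuous p := by
    refine continuous_of_cases hT (continuous_induced_rng.mpr ?_) (continuous_induced_rng.mpr ?_)
    · have : Subtype.val ∘ p ∘ h₁ = X.domRestrict P := funext hp₁
      rw [this]
      exact continuousOn_iff_continuous_domRestrict.mp hP.continuousOn_left
    · have : Subtype.val ∘ p ∘ h₂ = Q ∘ Subtype.val := funext hp₂
      rw [this]
      exact hP.continuous_right.comp continuous_subtype_val
  have hsurj : Function.Surjective p := by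
    rintro ⟨_, ⟨x, hx, rfl⟩ | ⟨y, hy, rfl⟩⟩
    · exact ⟨h₁ ⟨x, hx⟩, Subtype.ext (hp₁ _)⟩
    · exact ⟨h₂ ⟨y, hy⟩, Subtype.ext (hp₂ _)⟩
  have heq : ∀ t t', p t = p t' ↔ (t, t') ∈ attachingRel h₁ h₂ hAX f := by
    obtain ⟨r₁₁, r₁₂, r₂₁, r₂₂⟩ := mem_attachingRel_iff (hAX := hAX) (f := f) hT
    have hright : ∀ (x : X) (y : Y), P x = Q y ↔ ∃ hx : (x : Fin m → F) ∈ A, f ⟨x, hx⟩ = y := by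
      intro x y
      rw [hP.eq_right_iff x.2]
      constructor
      · rintro ⟨hx, h⟩
        exact ⟨hx, Subtype.ext (by rw [← h, extendZero_of_mem f hx])⟩
      · rintro ⟨hx, rfl⟩
        exact ⟨hx, extendZero_of_mem f hx⟩
    intro t t'
    rcases hT.cases t with ⟨x, rfl⟩ | ⟨y, rfl⟩ <;> rcases hT.cases t' with ⟨x', rfl⟩ | ⟨y', rfl⟩
    · rw [r₁₁, Subtype.ext_iff, hp₁, hp₁, hP.eq_left_iff x.2 x'.2, Subtype.ext_iff]
      refine or_congr_right ⟨?_, ?_⟩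
      · rintro ⟨hx, hx', h⟩
        rw [extendZero_of_mem f hx, extendZero_of_mem f hx'] at h
        exact ⟨hx, hx', Subtype.ext h⟩
      · rintro ⟨hx, hx', h⟩
        rw [extendZero_of_mem f hx, extendZero_of_mem f hx', h]
        exact ⟨hx, hx', rfl⟩
    · rw [r₁₂, Subtype.ext_iff, hp₁, hp₂, hright]
    · rw [r₂₁, Subtype.ext_iff, hp₁, hp₂, eq_comm, hright]
    · rw [r₂₂, Subtype.ext_iff, hp₂, hp₂, hP.right_injective.eq_iff, Subtype.ext_iff]
  -- Since `E(f)` is the kernel of `p`, both its definability and the equivalence axioms come from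
  -- `p`.
  refine ⟨Z, p, ⟨isDefinableEquivalence_of_eq_iff hmap heq, ⟨hmap, hcont, hsurj, ?_⟩, heq⟩,
    ⟨hmap, hcont, ?_⟩⟩
  · intro K hK hKZ hcl
    rw [isClosed_subtype_iff]
    have hclX : IsClosed {x : X | P x ∈ K} := by
      simpa only [preimage_ofPred_eq, hp₁] using hcl.preimage hT.embedding_left.continuous
    have hclY : IsClosed {y : Y | Q y ∈ K} := by
      simpa only [preimage_ofPred_eq, hp₂] using hcl.preimage hT.embedding_right.continuous
    intro z hz hzK
    exact hP.mem_of_mem_closure hc hρ hfY hK hKZ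
      (isClosed_subtype_iff (B := {x | P x ∈ K}).mp hclX)
      (isClosed_subtype_iff (B := {y | Q y ∈ K}).mp hclY) hz (closure_mono (fun _ h => h.2) hzK)
  · intro K hK hKZ hKc hKb
    -- Closedness is required in `F ^ k`, not just in `T`. It is obtained by writing the inverse
    -- image as a union of two continuous images of closed bounded sets.
    have hpre : {t | ∃ ht : t ∈ T, (p ⟨t, ht⟩ : Fin N → F) ∈ K} =
        extendZero h₁ '' {x | x ∈ X ∧ P x ∈ K} ∪ extendZero h₂ '' {y | y ∈ Y ∧ Q y ∈ K} := by
      ext t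
      constructor
      · rintro ⟨ht, hK⟩
        rcases hT.cases ⟨t, ht⟩ with ⟨x, hx⟩ | ⟨y, hy⟩
        · rw [← hx, hp₁] at hK
          exact Or.inl ⟨x, ⟨x.2, hK⟩, by rw [extendZero_coe, hx]⟩
        · rw [← hy, hp₂] at hK
          exact Or.inr ⟨y, ⟨y.2, hK⟩, by rw [extendZero_coe, hy]⟩
      · rintro (⟨x, ⟨hx, hK⟩, rfl⟩ | ⟨y, ⟨hy, hK⟩, rfl⟩)
        · rw [extendZero_of_mem h₁ hx]
          exact ⟨(h₁ ⟨x, hx⟩).2, by rwa [hp₁]⟩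
        · rw [extendZero_of_mem h₂ hy]
          exact ⟨(h₂ ⟨y, hy⟩).2, by rwa [hp₂]⟩
    have hK' : Def L F (· ∈ K) := hK
    obtain ⟨hcX, hbX⟩ := hP.proper_preimage_left hc hρ hfY hK' hKZ hKc hKb
    obtain ⟨hcY, hbY⟩ := hP.proper_preimage_right hc hfY hK' hKZ hKc hKb
    have hdX : Def L F (· ∈ {x | x ∈ X ∧ P x ∈ K}) := hX.and (hK'.comp hPd)
    have hdY : Def L F (· ∈ {y | y ∈ Y ∧ Q y ∈ K}) := hY.and (hK'.comp hQd)
    have hf₁ := hT.definable_left.defFun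
    have hf₂ := hT.definable_right.defFun
    have hc₁ : ContinuousOn (extendZero h₁) {x | x ∈ X ∧ P x ∈ K} :=
      (continuousOn_extendZero hT.embedding_left.continuous).mono fun x hx => hx.1
    have hc₂ : ContinuousOn (extendZero h₂) {y | y ∈ Y ∧ Q y ∈ K} :=
      (continuousOn_extendZero hT.embedding_right.continuous).mono fun y hy => hy.1
    rw [hpre]
    exact ⟨(isClosed_image_of_isBdd hc hcX hbX hdX hf₁ hc₁).union
      (isClosed_image_of_isBdd hc hcY hbY hdY hf₂ hc₂),
      (isBdd_image_of_isClosed hc hcX hbX hdX hf₁ hc₁).union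
      (isBdd_image_of_isClosed hc hcY hbY hdY hf₂ hc₂)⟩

end Quotient

end DefinableQuotient

/-! ### The attaching space as a definable proper quotient -/

theorem mainTheorem8 {L : FirstOrder.Language} {F : Type*} [Field F] [LinearOrder F]
    [IsStrictOrderedRing F] [TopologicalSpace F] [OrderTopology F] [L.Structure F]
    (hF : DefinableQuotient.ExpandsOrderedField L F)
    (hcomplete : DefinableQuotient.DefinablyComplete L F)
    (hlocal : DefinableQuotient.LocallyOMinimal L F)
    {m n : ℕ} {X A : Set (Fin m → F)} {Y : Set (Fin n → F)}
    (hX : DefinableQuotient.IsDefinable L X)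
    (hY : DefinableQuotient.IsDefinable L Y)
    (hA : DefinableQuotient.IsDefinable L A)
    (hAX : A ⊆ X)
    (hXlc : IsLocallyClosed X)
    (hAcl : IsClosed {x : X | (x : Fin m → F) ∈ A})
    (f : A → Y) (hf : DefinableQuotient.DefinablyProper L f) :
    (∃ (k : ℕ) (T : Set (Fin k → F)) (h₁ : X → T) (h₂ : Y → T),
      DefinableQuotient.IsDisjointSum L h₁ h₂) ∧
    ∀ (k : ℕ) (T : Set (Fin k → F)) (h₁ : X → T) (h₂ : Y → T),
      DefinableQuotient.IsDisjointSum L h₁ h₂ →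
        ∃ (N : ℕ) (Z : Set (Fin N → F)) (p : T → Z),
          DefinableQuotient.IsDefinableProperQuotient L
            (DefinableQuotient.attachingRel h₁ h₂ hAX f) p := by
  open DefinableQuotient in
  have : Fact (ExpandsOrderedField L F) := ⟨hF⟩
  refine ⟨exists_disjointSum hX hY, fun k T h₁ h₂ hT => ?_⟩
  obtain ⟨ρ, hρ⟩ := exists_exhaustion hcomplete hX hXlc
  have hcl : ∀ x ∈ X, x ∈ closure A → x ∈ A := fun x hx hxA => by
    have hsub : A ⊆ {x | x ∈ X ∧ x ∈ A} := fun a ha => ⟨hAX ha, ha⟩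
    exact isClosed_subtype_iff.mp hAcl x hx (closure_mono hsub hxA)
  have hprop : ∀ K : Set (Fin n → F), IsDefinable L K → K ⊆ Y → IsClosed K → IsBdd K →
      IsClosed {x | x ∈ A ∧ extendZero f x ∈ K} ∧ IsBdd {x | x ∈ A ∧ extendZero f x ∈ K} := by
    intro K hK hKY hKc hKb
    have heq : {x | x ∈ A ∧ extendZero f x ∈ K} =
        {x | ∃ hx : x ∈ A, (f ⟨x, hx⟩ : Fin n → F) ∈ K} := by
      ext x
      constructor
      · rintro ⟨hx, h⟩
        exact ⟨hx, by rwa [extendZero_of_mem f hx] at h⟩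
      · rintro ⟨hx, h⟩
        exact ⟨hx, by rwa [extendZero_of_mem f hx]⟩
    rw [heq]
    exact hf.proper K hK hKY hKc hKb
  obtain ⟨P, Q, Γ, e, hP⟩ := exists_gluing hcomplete (Y := Y) hρ hA hAX hcl hf.definable.defFun
    (continuousOn_extendZero hf.continuous)
    (fun a ha => by rw [extendZero_of_mem f ha]; exact (f _).2) hprop
  exact ⟨_, hP.exists_properQuotient hcomplete hρ hT⟩
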